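/- Let $n,p,m\in\mathbb{N}$ with $p\le n$, let $X=L^2(0,1;\mathbb{C}^n)$, let $\lambda_0\in L^\infty(0,1;\mathbb{R})$ satisfy $\lambda_0(\zeta)\ge\epsilon$ for a.e. $\zeta\in(0,1)$ and some $\epsilon>0$, let $M\in L^\infty(0,1;\mathbb{C}^{n\times n})$, and let $K,L\in\mathbb{C}^{n\times n}$, $K_y,L_y\in\mathbb{C}^{m\times n}$. Consider the boundary controlled, boundary observed system \begin{align*} \frac{\partial z}{\partial t}(\zeta,t)&=-\frac{\partial}{\partial\zeta}\bigl(\lambda_0(\zeta)z(\zeta,t)\bigr)+M(\zeta)z(\zeta,t),\qquad z(\zeta,0)=z_0(\zeta),\\ \begin{bmatrix}0\\ I\end{bmatrix}u(t)&=-\lambda_0(0)Kz(0,t)-\lambda_0(1)Lz(1,t),\\ y(t)&=-\lambda_0(0)K_yz(0,t)-\lambda_0(1)L_yz(1,t), \end{align*} for $\zeta\in(0,1)$, $t\ge0$, with state $z(\cdot,t)\in X$, input $u(t)\in\mathbb{C}^p$ and output $y(t)\in\mathbb{C}^m$, where $\begin{bmatrix}0\\ I\end{bmatrix}\in\mathbb{C}^{n\times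 p}$ and $I$ is the $p\times p$ identity. For $v\in X$ with $\lambda_0v\in H^1(0,1;\mathbb{C}^n)$, write $(\lambda_0v)(0)$ and $(\lambda_0v)(1)$ for the boundary values of the continuous representative of $\lambda_0v$; $L^2_{\mathrm{loc}}(0,\infty;E)$ denotes the functions that lie in $L^2(0,T;E)$ for every $T>0$. A mild solution for $z_0\in X$ and $u\in L^2_{\mathrm{loc}}(0,\infty;\mathbb{C}^p)$ is a continuous function $z:[0,\infty)\to X$ such that for every $t\ge0$ the function $Z_t=\int_0^tz(s)\,ds$ satisfies $\lambda_0Z_t\in H^1(0,1;\mathbb{C}^n)$, $$z(t)=z_0-(\lambda_0Z_t)'+MZ_t\quad\text{in }X,\qquad \begin{bmatrix}0\\ I\end{bmatrix}\int_0^tu(s)\,ds=-K(\lambda_0Z_t)(0)-L(\lambda_0Z_t)(1).$$ A function $y\in L^2_{\mathrm{loc}}(0,\infty;\mathbb{C}^m)$ is its output if $\int_0^ty(s)\,ds=-K_y(\lambda_0Z_t)(0)-L_y(\lambda_0Z_t)(1)$ for every $t\ge0$. The system is called well-posed if for every $z_0\in X$ and every $u\in L^2_{\mathrm{loc}}(0,\infty;\mathbb{C}^p)$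 there exists exactly one mild solution, and this solution has an output $y\in L^2_{\mathrm{loc}}(0,\infty;\mathbb{C}^m)$. Then the system is well-posed if and only if the matrix $K$ is invertible. -/

import Mathlib

open MeasureTheory

noncomputable section

namespace WaveNetwork

/-- Lebesgue measure on the spatial interval `(0, 1)`. -/
abbrev spaceMeasure : Measure ℝ := volume.restrict (Set.Ioo 0 1)

/-- The state space `X = L²(0, 1; ℂⁿ)`. -/
abbrev State (n : ℕ) : Type := Lp (EuclideanSpace ℂ (Fin n)) 2 spaceMeasure

/-- `L²_loc(0, ∞; E)`: the functions of time that are square integrable on `(0, T)`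
for every finite `T`. -/
def IsL2loc {E : Type*} [NormedAddCommGroup E] (v : ℝ → E) : Prop :=
  ∀ T : ℝ, 0 < T → MemLp v 2 (volume.restrict (Set.Ioo 0 T))

/-- The `n × p` matrix whose last `p` rows form the identity and whose other rows vanish
(used for `p ≤ n`). -/
def inputMatrix (n p : ℕ) : Matrix (Fin n) (Fin p) ℂ :=
  Matrix.of fun i j => if (i : ℕ) = (n - p) + (j : ℕ) then 1 else 0

/-- `lam • f` lies in the Sobolev space `H¹(0, 1; ℂⁿ)`, its (absolutely) continuous
representative on `[0, 1]` is `w`, and its weak derivative is `g ∈ L²(0, 1; ℂⁿ)`. The boundary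
values "`lam(0) f(0)`" and "`lam(1) f(1)`" are the traces `w 0` and `w 1`. -/
structure IsFlux {n : ℕ} (lam : ℝ → ℝ) (f : State n)
    (w : ℝ → EuclideanSpace ℂ (Fin n)) (g : State n) : Prop where
  ae_eq : ∀ᵐ ζ ∂spaceMeasure, w ζ = (lam ζ : ℂ) • f ζ
  eq_integral : ∀ ζ ∈ Set.Icc (0 : ℝ) 1, w ζ = w 0 + ∫ s in (0 : ℝ)..ζ, g s

/-- `z` is a mild solution, with initial state `z₀` and input `u`, of
`∂z/∂t = -∂(lam z)/∂ζ + M z`, `[0; I] u(t) = -lam(0) K z(0,t) - lam(1) L z(1,t)`: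
`z` is a continuous `X`-valued function of time, and for every `t ≥ 0` the time integral
`Z = ∫₀ᵗ z(s) ds` satisfies `lam Z ∈ H¹`, `z(t) = z₀ - (lam Z)' + M Z` and the time-integrated
boundary condition. -/
structure IsMildSolution {n p : ℕ} (lam : ℝ → ℝ) (M : ℝ → Matrix (Fin n) (Fin n) ℂ)
    (K L : Matrix (Fin n) (Fin n) ℂ) (z₀ : State n) (u : ℝ → EuclideanSpace ℂ (Fin p))
    (z : ℝ → State n) : Prop where
  continuousOn : ContinuousOn z (Set.Ici 0)
  integrated : ∀ t : ℝ, 0 ≤ t →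
    ∃ (w : ℝ → EuclideanSpace ℂ (Fin n)) (g : State n),
      IsFlux lam (∫ s in (0 : ℝ)..t, z s) w g ∧
      (∀ᵐ ζ ∂spaceMeasure, (z t : ℝ → EuclideanSpace ℂ (Fin n)) ζ =
        z₀ ζ - g ζ + (M ζ).toEuclideanLin ((∫ s in (0 : ℝ)..t, z s : State n) ζ)) ∧
      (inputMatrix n p).toEuclideanLin (∫ s in (0 : ℝ)..t, u s) =
        -K.toEuclideanLin (w 0) - L.toEuclideanLin (w 1)

/-- `y` is the output `y(t) = -lam(0) Ky z(0,t) - lam(1) Ly z(1,t)` along the mild solution `z`,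
the equation being understood, as for the boundary condition, after integration over
`[0, t]` for every `t ≥ 0`. -/
def IsOutput {n m : ℕ} (lam : ℝ → ℝ) (Ky Ly : Matrix (Fin m) (Fin n) ℂ)
    (z : ℝ → State n) (y : ℝ → EuclideanSpace ℂ (Fin m)) : Prop :=
  ∀ t : ℝ, 0 ≤ t →
    ∃ (w : ℝ → EuclideanSpace ℂ (Fin n)) (g : State n),
      IsFlux lam (∫ s in (0 : ℝ)..t, z s) w g ∧
      ∫ s in (0 : ℝ)..t, y s = -Ky.toEuclideanLin (w 0) - Ly.toEuclideanLin (w 1)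

/-- Well-posedness: for every initial state in `X` and every input in `L²_loc(0, ∞; ℂᵖ)` there is
exactly one mild solution (as a function on `[0, ∞)`) and its output exists
in `L²_loc(0, ∞; ℂᵐ)`. -/
def WellPosed {n m : ℕ} (p : ℕ) (lam : ℝ → ℝ) (M : ℝ → Matrix (Fin n) (Fin n) ℂ)
    (K L : Matrix (Fin n) (Fin n) ℂ) (Ky Ly : Matrix (Fin m) (Fin n) ℂ) : Prop :=
  ∀ (z₀ : State n) (u : ℝ → EuclideanSpace ℂ (Fin p)), IsL2loc u →
    ∃ z : ℝ → State n, IsMildSolution lam M K L z₀ u z ∧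
      (∀ z' : ℝ → State n, IsMildSolution lam M K L z₀ u z' → Set.EqOn z' z (Set.Ici 0)) ∧
      ∃ y : ℝ → EuclideanSpace ℂ (Fin m), IsL2loc y ∧ IsOutput lam Ky Ly z y

end WaveNetwork

end

/-!
The equation is a transport equation with a common speed `lam` for all components, so it can be
solved along characteristics. Put `r = 1 / lam`, let `τ(ζ) = ∫₀^ζ r` be the travel time and
`T = τ(1)`. If `Q` is the fundamental matrix of `Q' = r M Q`, `Q(0) = 1`, then multiplication of
the flux `lam z` by `R = Q⁻¹` removes the zero order term, and the solutions are exactly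
`z(ζ, t) = r(ζ) Q(ζ) φ(t - τ(ζ))` for a profile `φ` that is square integrable on bounded parts of
`(-T, ∞)`. On `(-T, 0)` the profile encodes the initial state, and the flux has the traces `φ(t)`
at `0` and `Q(1) φ(t - T)` at `1`. The boundary condition thus becomes the delay equation
`K φ(t) + L Q(1) φ(t - T) = -[0; I] u(t)`.

Two facts make this rigorous for mild solutions. `exists_solution_of_profile` shows that every
profile gives a solution of the differential equation; continuity in time is the continuity of
translations in `L²`. Conversely, `IsNullSolution.transport` shows that the integrated flux of a
solution with zero initial state is constant along characteristics in the frame `R`, and zero where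
no signal from the boundary has arrived. It rests on `transport_eq`: an integrated form of
`∂ₜ W + ∂ₓ W = 0` for a merely continuous `W` forces `W(t + x, x) = W(t, 0)`.

If `K` is invertible, the delay equation is solved by the finite sum of `exists_profile_delay`,
and the transport property together with induction over intervals of length `T` gives uniqueness.
The output is `-K_y φ(t) - L_y Q(1) φ(t - T)`.

Suppose conversely that the system is well-posed. Up to time `T` the trace at `1` depends on the
initial state only and can be prescribed; with `u = 0` the boundary condition then forces
`range L ⊆ range K` (`range_le_of_wellPosed`). Hence `L = K G` for some `G`. If `K v = 0` with
`v ≠ 0`, the profile that solves `φ(t) = v - G Q(1) φ(t - T)` for `0 ≤ t < T` and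
`φ(t) = -G Q(1) φ(t - T)` afterwards satisfies the homogeneous boundary condition and starts from
the zero state, so that uniqueness fails (`isUnit_of_wellPosed`).
-/

noncomputable section

namespace WaveNetwork

open Set Filter Topology

/-! ### Integral identities -/

section Calculus

open intervalIntegral

theorem _root_.IntervalIntegrable.bilin_continuousOn {𝕜 E F G : Type*} [RCLike 𝕜]
    [NormedAddCommGroup E] [NormedSpace 𝕜 E] [NormedAddCommGroup F] [NormedSpace 𝕜 F]
    [NormedAddCommGroup G] [NormedSpace 𝕜 G] (B : E →L[𝕜] F →L[𝕜] G) {a : ℝ → E}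
    {k : ℝ → F} {c d : ℝ} (ha : IntervalIntegrable a volume c d) (hk : ContinuousOn k (uIcc c d)) :
    IntervalIntegrable (fun s => B (a s) (k s)) volume c d := by
  obtain ⟨C, hC⟩ := isCompact_uIcc.exists_bound_of_continuousOn hk
  rw [intervalIntegrable_iff] at ha ⊢
  refine Integrable.mono' (g := fun s => ‖B‖ * ‖a s‖ * C) ((ha.norm.const_mul _).mul_const _)
    (B.aestronglyMeasurable_comp₂ ha.aestronglyMeasurable
      ((hk.mono uIoc_subset_uIcc).aestronglyMeasurable measurableSet_uIoc)) ?_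
  filter_upwards [ae_restrict_mem measurableSet_uIoc] with s hs
  exact (B.le_opNorm₂ _ _).trans (by gcongr; exact hC s (uIoc_subset_uIcc hs))

variable {𝕜 E F G : Type*} [RCLike 𝕜]
  [NormedAddCommGroup E] [NormedSpace ℝ E] [NormedSpace 𝕜 E] [CompleteSpace E]
  [NormedAddCommGroup F] [NormedSpace ℝ F] [NormedSpace 𝕜 F] [CompleteSpace F]
  [NormedAddCommGroup G] [NormedSpace ℝ G] [NormedSpace 𝕜 G] [CompleteSpace G]

/-- Fubini's theorem on the square `[0, ζ]²`, split along its diagonal. -/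
theorem bilin_integral_eq (B : E →L[𝕜] F →L[𝕜] G) {a : ℝ → E} {b : ℝ → F} {ζ : ℝ} (hζ : 0 ≤ ζ)
    (ha : IntervalIntegrable a volume 0 ζ) (hb : IntervalIntegrable b volume 0 ζ) :
    B (∫ s in (0 : ℝ)..ζ, a s) (∫ s in (0 : ℝ)..ζ, b s) =
      (∫ s in (0 : ℝ)..ζ, B (a s) (∫ t in (0 : ℝ)..s, b t)) +
        ∫ s in (0 : ℝ)..ζ, B (∫ t in (0 : ℝ)..s, a t) (b s) := by
  have hab : Integrable (fun p : ℝ × ℝ => B (a p.1) (b p.2))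
      ((volume.restrict (Ioc 0 ζ)).prod (volume.restrict (Ioc 0 ζ))) :=
    Integrable.op_fst_snd (op := fun x y => B x y) (by fun_prop)
      ⟨‖B‖, fun x y => B.le_opNorm₂ x y⟩ ha.1 hb.1
  have hS : MeasurableSet {p : ℝ × ℝ | p.2 ≤ p.1} := measurableSet_le measurable_snd measurable_fst
  have h1 : ∫ s in (0 : ℝ)..ζ, B (a s) (∫ t in (0 : ℝ)..s, b t) =
      ∫ p, {p : ℝ × ℝ | p.2 ≤ p.1}.indicator (fun p => B (a p.1) (b p.2)) p
        ∂((volume.restrict (Ioc 0 ζ)).prod (volume.restrict (Ioc 0 ζ))) := by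
    rw [integral_prod _ (hab.indicator hS), integral_of_le hζ]
    refine setIntegral_congr_fun measurableSet_Ioc fun s hs => ?_
    have : ∫ t in (0 : ℝ)..s, b t = ∫ t in Ioc 0 ζ, (Iic s).indicator b t := by
      rw [integral_of_le hs.1.le, setIntegral_indicator measurableSet_Iic, Ioc_inter_Iic,
        min_eq_right hs.2]
    rw [this, ← ContinuousLinearMap.integral_comp_comm _ (hb.1.indicator measurableSet_Iic)]
    congr 1
    ext t
    by_cases h : t ≤ s <;> simp [indicator, h]
  have h2 : ∫ s in (0 : ℝ)..ζ, B (∫ t in (0 : ℝ)..s, a t) (b s) =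
      ∫ p, {p : ℝ × ℝ | p.2 ≤ p.1}ᶜ.indicator (fun p => B (a p.1) (b p.2)) p
        ∂((volume.restrict (Ioc 0 ζ)).prod (volume.restrict (Ioc 0 ζ))) := by
    rw [integral_prod_symm _ (hab.indicator hS.compl), integral_of_le hζ]
    refine setIntegral_congr_fun measurableSet_Ioc fun s hs => ?_
    have : ∫ t in (0 : ℝ)..s, a t = ∫ t in Ioc 0 ζ, (Iio s).indicator a t := by
      rw [integral_of_le hs.1.le, integral_Ioc_eq_integral_Ioo,
        setIntegral_indicator measurableSet_Iio]
      congr 2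
      ext t
      simp only [mem_Ioo, mem_inter_iff, mem_Ioc, mem_Iio]
      have := hs.2
      grind
    rw [this]
    have h3 := ContinuousLinearMap.integral_comp_comm (B.flip (b s))
      (ha.1.indicator (measurableSet_Iio (a := s)))
    simp only [ContinuousLinearMap.flip_apply] at h3
    rw [← h3]
    congr 1
    ext t
    by_cases h : t < s <;> simp [indicator, h]
  rw [h1, h2, ← integral_add (hab.indicator hS) (hab.indicator hS.compl)]
  simp only [indicator_self_add_compl_apply]
  rw [integral_prod _ hab, integral_of_le hζ, integral_of_le hζ]
  have h4 := ContinuousLinearMap.integral_comp_comm (B.flip (∫ s in Ioc 0 ζ, b s)) ha.1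
  simp only [ContinuousLinearMap.flip_apply] at h4
  rw [← h4]
  refine integral_congr_ae (Eventually.of_forall fun s => ?_)
  exact ((B (a s)).integral_comp_comm hb.1).symm

/-- The product rule for absolutely continuous functions, in integrated form. -/
theorem bilin_eq_add_integral (B : E →L[𝕜] F →L[𝕜] G) {f a : ℝ → E} {g b : ℝ → F} {c : ℝ}
    (ha : IntervalIntegrable a volume 0 c) (hb : IntervalIntegrable b volume 0 c)
    (hf : ∀ ζ ∈ Icc 0 c, f ζ = f 0 + ∫ s in (0 : ℝ)..ζ, a s)
    (hg : ∀ ζ ∈ Icc 0 c, g ζ = g 0 + ∫ s in (0 : ℝ)..ζ, b s) :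
    ∀ ζ ∈ Icc 0 c, B (f ζ) (g ζ) =
      B (f 0) (g 0) + ∫ s in (0 : ℝ)..ζ, (B (a s) (g s) + B (f s) (b s)) := by
  intro ζ hζ
  have hsub : uIcc 0 ζ ⊆ uIcc 0 c := by
    rw [uIcc_of_le hζ.1, uIcc_of_le (hζ.1.trans hζ.2)]; exact Icc_subset_Icc_right hζ.2
  replace ha := ha.mono_set hsub
  replace hb := hb.mono_set hsub
  have hA : ContinuousOn (fun s => ∫ t in (0 : ℝ)..s, a t) (uIcc 0 ζ) :=
    continuousOn_primitive_interval ((intervalIntegrable_iff' (by simp)).1 ha)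
  have hB : ContinuousOn (fun s => ∫ t in (0 : ℝ)..s, b t) (uIcc 0 ζ) :=
    continuousOn_primitive_interval ((intervalIntegrable_iff' (by simp)).1 hb)
  have i1 := ha.bilin_continuousOn B (continuousOn_const (c := g 0))
  have i2 := ha.bilin_continuousOn B hB
  have i3 := hb.bilin_continuousOn B.flip (continuousOn_const (c := f 0))
  have i4 := hb.bilin_continuousOn B.flip hA
  simp only [ContinuousLinearMap.flip_apply] at i3 i4
  have h1 : ∫ s in (0 : ℝ)..ζ, B (a s) (g 0) = B (∫ s in (0 : ℝ)..ζ, a s) (g 0) :=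
    (B.flip (g 0)).intervalIntegral_comp_comm ha
  have h3 : ∫ s in (0 : ℝ)..ζ, B (f 0) (b s) = B (f 0) (∫ s in (0 : ℝ)..ζ, b s) :=
    (B (f 0)).intervalIntegral_comp_comm hb
  have h5 : ∫ s in (0 : ℝ)..ζ, (B (a s) (g s) + B (f s) (b s)) =
      ∫ s in (0 : ℝ)..ζ, ((B (a s) (g 0) + B (a s) (∫ t in (0 : ℝ)..s, b t)) +
        (B (f 0) (b s) + B (∫ t in (0 : ℝ)..s, a t) (b s))) := by
    refine integral_congr fun s hs => ?_
    rw [uIcc_of_le hζ.1] at hs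
    have hs' : s ∈ Icc 0 c := ⟨hs.1, hs.2.trans hζ.2⟩
    simp only [hf s hs', hg s hs', map_add, add_apply]
  rw [h5, integral_add (i1.add i2) (i3.add i4), integral_add i1 i2, integral_add i3 i4, h1, h3,
    hf ζ hζ, hg ζ hζ, map_add, map_add, add_apply,
    add_apply, bilin_integral_eq B hζ.1 ha hb]
  abel

theorem eqOn_zero_of_integral_eq_zero {f : ℝ → E} {b : ℝ} (hb : 0 < b)
    (hf : ContinuousOn f (Icc 0 b)) (h : ∀ t ∈ Icc 0 b, ∫ s in (0 : ℝ)..t, f s = 0) :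
    ∀ t ∈ Icc 0 b, f t = 0 := by
  intro t ht
  have : Fact (t ∈ Icc 0 b) := ⟨ht⟩
  have hint : IntervalIntegrable f volume 0 t :=
    (hf.mono (by rw [uIcc_of_le ht.1]; exact Icc_subset_Icc_right ht.2)).intervalIntegrable
  have h1 : HasDerivWithinAt (fun u => ∫ s in (0 : ℝ)..u, f s) (f t) (Icc 0 b) t :=
    integral_hasDerivWithinAt_right hint
      (hf.stronglyMeasurableAtFilter_nhdsWithin measurableSet_Icc t) (hf t ht)
  have h2 : HasDerivWithinAt (fun u => ∫ s in (0 : ℝ)..u, f s) 0 (Icc 0 b) t :=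
    (hasDerivWithinAt_const t (Icc 0 b) (0 : E)).congr h (h t ht)
  exact (uniqueDiffOn_Icc hb t ht).eq_deriv _ h1 h2

theorem eq_zero_of_integral_eq_zero {f : ℝ → E} (hf : ContinuousOn f (Ici 0))
    (h : ∀ t, 0 ≤ t → ∫ s in (0 : ℝ)..t, f s = 0) : ∀ t, 0 ≤ t → f t = 0 := fun t ht =>
  eqOn_zero_of_integral_eq_zero (b := t + 1) (by linarith) (hf.mono Icc_subset_Ici_self)
    (fun s hs => h s hs.1) t ⟨ht, by linarith⟩

/-- The hypothesis `h` is the equation `∂ₜ W + ∂ₓ W = 0`, integrated in both variables and thus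
meaningful for a merely continuous `W`. The time integral `V(t, x) = ∫₀ᵗ W(s, x) ds` has
continuous partial derivatives `W` and `-W`, hence it is constant along the lines
`t - x = const`. -/
theorem transport_integral_const {T : ℝ} {W : ℝ → ℝ → E}
    (hW : ContinuousOn (fun q : ℝ × ℝ => W q.1 q.2) (Ici 0 ×ˢ Icc 0 T))
    (h : ∀ t, 0 ≤ t → ∀ x ∈ Icc 0 T,
      (∫ s in (0 : ℝ)..t, W s x) = (∫ s in (0 : ℝ)..t, W s 0) - ∫ y in (0 : ℝ)..x, W t y)
    {t x m : ℝ} (ht : 0 ≤ t) (hx : 0 ≤ x) (hm : 0 ≤ m) (hxm : x + m ≤ T) :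
    (∫ s in (0 : ℝ)..(t + m), W s (x + m)) = ∫ s in (0 : ℝ)..t, W s x := by
  have hc1 : ∀ y ∈ Icc 0 T, ContinuousOn (fun s => W s y) (Ici 0) := fun y hy =>
    hW.comp (f := fun s => (s, y)) (by fun_prop) fun s hs => ⟨hs, hy⟩
  have hc2 : ∀ s, 0 ≤ s → ContinuousOn (fun y => W s y) (Icc 0 T) := fun s hs =>
    hW.comp (f := fun y => (s, y)) (by fun_prop) fun y hy => ⟨hs, hy⟩
  have hi1 : ∀ y ∈ Icc 0 T, ∀ c d, 0 ≤ c → 0 ≤ d →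
      IntervalIntegrable (fun s => W s y) volume c d := fun y hy c d hc hd =>
    ((hc1 y hy).mono fun s hs => (le_min hc hd).trans hs.1).intervalIntegrable
  have hi2 : ∀ s, 0 ≤ s → ∀ c ∈ Icc 0 T, ∀ d ∈ Icc 0 T,
      IntervalIntegrable (fun y => W s y) volume c d := fun s hs c hc d hd =>
    ((hc2 s hs).mono (uIcc_subset_Icc hc hd)).intervalIntegrable
  -- the increment of the time integral along a characteristic
  have key : ∀ t' x' δ, 0 ≤ t' → 0 ≤ x' → 0 ≤ δ → x' + δ ≤ T →
      (∫ s in (0 : ℝ)..(t' + δ), W s (x' + δ)) - (∫ s in (0 : ℝ)..t', W s x') =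
        (∫ s in t'..(t' + δ), W s (x' + δ)) - ∫ y in x'..(x' + δ), W t' y := by
    intro t' x' δ ht' hx' hδ hT
    have hx1 : x' ∈ Icc 0 T := ⟨hx', by linarith⟩
    have hx2 : x' + δ ∈ Icc 0 T := ⟨by linarith, hT⟩
    rw [← integral_add_adjacent_intervals (hi1 _ hx2 0 t' le_rfl ht')
      (hi1 _ hx2 t' (t' + δ) ht' (by linarith)), h t' ht' _ hx2, h t' ht' _ hx1,
      ← integral_add_adjacent_intervals (hi2 t' ht' 0 ⟨le_rfl, hx1.1.trans hx1.2⟩ x' hx1)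
      (hi2 t' ht' x' hx1 _ hx2)]
    abel
  have hcont : ContinuousOn (fun s => ∫ u in (0 : ℝ)..(t + s), W u (x + s)) (Icc 0 m) := by
    obtain ⟨C, hC⟩ := (isCompact_Icc.prod isCompact_Icc).exists_bound_of_continuousOn
      (hW.mono (Set.prod_mono (Icc_subset_Ici_self (b := (0 : ℝ)) (a := t + m)) Subset.rfl))
    have hC0 : 0 ≤ C := (norm_nonneg _).trans
      (hC (0, 0) ⟨⟨le_rfl, by linarith⟩, le_rfl, by linarith⟩)
    have hle : ∀ s₁ ∈ Icc 0 m, ∀ s₂ ∈ Icc 0 m, s₁ ≤ s₂ →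
        ‖(∫ u in (0 : ℝ)..(t + s₂), W u (x + s₂)) - ∫ u in (0 : ℝ)..(t + s₁), W u (x + s₁)‖ ≤
          2 * C * (s₂ - s₁) := by
      intro s₁ h₁ s₂ h₂ h₁₂
      obtain ⟨δ, rfl⟩ : ∃ δ, s₂ = s₁ + δ := ⟨s₂ - s₁, by ring⟩
      have hs0 := h₁.1
      have hs1 := h₂.2
      have hk := key (t + s₁) (x + s₁) δ (by linarith) (by linarith) (by linarith) (by linarith)
      rw [← add_assoc, ← add_assoc, hk]
      have e1 := norm_integral_le_of_norm_le_const (a := t + s₁) (b := t + s₁ + δ) (C := C)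
        (f := fun u => W u (x + s₁ + δ)) (by
          intro u hu
          rw [uIoc_of_le (by linarith)] at hu
          exact hC (u, x + s₁ + δ) ⟨⟨by linarith [hu.1], by linarith [hu.2]⟩,
            by linarith, by linarith⟩)
      have e2 := norm_integral_le_of_norm_le_const (a := x + s₁) (b := x + s₁ + δ) (C := C)
        (f := fun y => W (t + s₁) y) (by
          intro u hu
          rw [uIoc_of_le (by linarith)] at hu
          exact hC (t + s₁, u) ⟨⟨by linarith, by linarith⟩,
            by linarith [hu.1], by linarith [hu.2]⟩)
      rw [add_sub_cancel_left, abs_of_nonneg (by linarith)] at e1 e2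
      calc _ ≤ _ := norm_sub_le _ _
        _ ≤ C * δ + C * δ := add_le_add e1 e2
        _ = _ := by ring
    refine (LipschitzOnWith.of_dist_le_mul (K := ⟨2 * C, by positivity⟩)
      fun s₁ h₁ s₂ h₂ => ?_).continuousOn
    rw [Real.dist_eq]
    rcases le_total s₁ s₂ with h₁₂ | h₁₂
    · rw [dist_comm, dist_eq_norm, abs_sub_comm, abs_of_nonneg (by linarith)]
      exact hle s₁ h₁ s₂ h₂ h₁₂
    · rw [dist_eq_norm, abs_of_nonneg (by linarith)]
      exact hle s₂ h₂ s₁ h₁ h₁₂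
  have hder : ∀ s ∈ Ico 0 m,
      HasDerivWithinAt (fun s => ∫ u in (0 : ℝ)..(t + s), W u (x + s)) 0 (Ici s) s := by
    intro s hs
    have hp : (t + s, x + s) ∈ Ici (0 : ℝ) ×ˢ Icc 0 T :=
      ⟨by simp only [mem_Ici]; linarith [hs.1], by linarith [hs.1], by linarith [hs.2]⟩
    rw [hasDerivWithinAt_iff_isLittleO, Asymptotics.isLittleO_iff]
    intro ε hε
    obtain ⟨δ₀, hδ₀, hball⟩ := Metric.continuousWithinAt_iff.1 (hW _ hp) (ε / 2) (by positivity)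
    have hev : ∀ᶠ r in 𝓝[Ici s] s, r ∈ Ico s (s + min δ₀ (m - s)) :=
      Ico_mem_nhdsGE (by simp [hδ₀, hs.2])
    filter_upwards [hev] with r hr
    obtain ⟨δ, rfl⟩ : ∃ δ, r = s + δ := ⟨r - s, by ring⟩
    have hδ : 0 ≤ δ := by linarith [hr.1]
    have hδ1 : δ < δ₀ := by linarith [hr.2, min_le_left δ₀ (m - s)]
    have hδ2 : δ < m - s := by linarith [hr.2, min_le_right δ₀ (m - s)]
    have hs0 := hs.1
    have hk := key (t + s) (x + s) δ (by linarith) (by linarith) hδ (by linarith)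
    rw [smul_zero, sub_zero, ← add_assoc, ← add_assoc, hk, add_sub_cancel_left,
      Real.norm_of_nonneg hδ]
    have e1 : ‖(∫ u in (t + s)..(t + s + δ), W u (x + s + δ)) - δ • W (t + s) (x + s)‖
        ≤ ε / 2 * δ := by
      have := norm_integral_le_of_norm_le_const (a := t + s) (b := t + s + δ) (C := ε / 2)
        (f := fun u => W u (x + s + δ) - W (t + s) (x + s)) (by
          intro u hu
          rw [uIoc_of_le (by linarith)] at hu
          rw [← dist_eq_norm]
          refine (hball (x := (u, x + s + δ)) ⟨?_, ?_, ?_⟩ ?_).le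
          · exact mem_Ici.2 (by linarith [hu.1])
          · linarith
          · linarith
          · rw [Prod.dist_eq, max_lt_iff, Real.dist_eq, Real.dist_eq, abs_lt, abs_lt]
            refine ⟨⟨?_, ?_⟩, ?_, ?_⟩ <;> dsimp only <;> linarith [hu.1, hu.2])
      rw [integral_sub (hi1 _ ⟨by linarith, by linarith⟩ _ _ (by linarith) (by linarith))
        (by simp), intervalIntegral.integral_const, add_sub_cancel_left, abs_of_nonneg hδ] at this
      exact this
    have e2 : ‖(∫ y in (x + s)..(x + s + δ), W (t + s) y) - δ • W (t + s) (x + s)‖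
        ≤ ε / 2 * δ := by
      have := norm_integral_le_of_norm_le_const (a := x + s) (b := x + s + δ) (C := ε / 2)
        (f := fun y => W (t + s) y - W (t + s) (x + s)) (by
          intro u hu
          rw [uIoc_of_le (by linarith)] at hu
          rw [← dist_eq_norm]
          refine (hball (x := (t + s, u)) ⟨?_, ?_, ?_⟩ ?_).le
          · exact mem_Ici.2 (by linarith [hu.1])
          · linarith [hu.1]
          · linarith [hu.2]
          · rw [Prod.dist_eq, max_lt_iff, Real.dist_eq, Real.dist_eq, abs_lt, abs_lt]
            refine ⟨⟨?_, ?_⟩, ?_, ?_⟩ <;> dsimp only <;> linarith [hu.1, hu.2])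
      rw [integral_sub (hi2 _ (by linarith) _ ⟨by linarith, by linarith⟩ _
        ⟨by linarith, by linarith⟩) (by simp), intervalIntegral.integral_const, add_sub_cancel_left,
        abs_of_nonneg hδ] at this
      exact this
    calc _ = ‖((∫ u in (t + s)..(t + s + δ), W u (x + s + δ)) - δ • W (t + s) (x + s)) -
          ((∫ y in (x + s)..(x + s + δ), W (t + s) y) - δ • W (t + s) (x + s))‖ := by
          congr 1; abel
      _ ≤ ε / 2 * δ + ε / 2 * δ := (norm_sub_le _ _).trans (add_le_add e1 e2)
      _ = ε * δ := by ring
  simpa using constant_of_has_deriv_right_zero hcont hder m ⟨hm, le_rfl⟩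

/-- A continuous `W` with `∂ₜ W + ∂ₓ W = 0` in integrated form, where `W(0, ·) = 0` by the
hypothesis `h` at `t = 0`, is constant along characteristics. -/
theorem transport_eq {T : ℝ} (hT : 0 < T) {W : ℝ → ℝ → E}
    (hW : ContinuousOn (fun q : ℝ × ℝ => W q.1 q.2) (Ici 0 ×ˢ Icc 0 T))
    (h : ∀ t, 0 ≤ t → ∀ x ∈ Icc 0 T,
      (∫ s in (0 : ℝ)..t, W s x) = (∫ s in (0 : ℝ)..t, W s 0) - ∫ y in (0 : ℝ)..x, W t y)
    {t x : ℝ} (hx : x ∈ Icc 0 T) :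
    (0 ≤ t → W (t + x) x = W t 0) ∧ (t ∈ Icc 0 x → W t x = 0) := by
  have hc1 : ∀ y ∈ Icc 0 T, ContinuousOn (fun s => W s y) (Ici 0) := fun y hy =>
    hW.comp (f := fun s => (s, y)) (by fun_prop) fun s hs => ⟨hs, hy⟩
  have hi1 : ∀ y ∈ Icc 0 T, ∀ c d, 0 ≤ c → 0 ≤ d →
      IntervalIntegrable (fun s => W s y) volume c d := fun y hy c d hc hd =>
    ((hc1 y hy).mono fun s hs => (le_min hc hd).trans hs.1).intervalIntegrable
  have h0 : (0 : ℝ) ∈ Icc 0 T := ⟨le_rfl, hx.1.trans hx.2⟩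
  have hzero : ∀ s ∈ Icc 0 x, ∫ u in (0 : ℝ)..s, W u x = 0 := fun s hs => by
    have := transport_integral_const hW h (t := 0) (x := x - s) (m := s) le_rfl
      (by linarith [hs.2]) hs.1 (by linarith [hx.2])
    simpa using this
  constructor
  · intro ht
    have := eq_zero_of_integral_eq_zero (f := fun s => W (s + x) x - W s 0)
      (((hc1 x hx).comp (f := fun s => s + x) (by fun_prop) fun s hs => add_nonneg hs hx.1).sub
        (hc1 0 h0)) (fun s hs => by
        have e := transport_integral_const hW h (t := s) (x := 0) (m := x) hs le_rfl hx.1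
          (by linarith [hx.2])
        rw [intervalIntegral.integral_sub, integral_comp_add_right (fun u => W u x), zero_add,
          ← integral_interval_sub_left (hi1 x hx 0 _ le_rfl (by linarith [hx.1]))
            (hi1 x hx 0 x le_rfl hx.1), hzero x ⟨hx.1, le_rfl⟩]
        · rw [zero_add] at e
          rw [e, sub_zero, sub_self]
        · simpa using (hi1 x hx x (s + x) hx.1 (by linarith [hx.1])).comp_add_right x
        · exact hi1 0 h0 0 s le_rfl hs) t ht
    exact sub_eq_zero.1 this
  · intro ht
    rcases hx.1.eq_or_lt with h' | h'
    · subst h'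
      obtain rfl : t = 0 := le_antisymm ht.2 ht.1
      refine eqOn_zero_of_integral_eq_zero (f := fun y => W 0 y) hT
        (hW.comp (f := fun y => ((0 : ℝ), y)) (by fun_prop) fun y hy => ⟨self_mem_Ici, hy⟩)
        (fun y hy => ?_) 0 hx
      simpa using h 0 le_rfl y hy
    · exact eqOn_zero_of_integral_eq_zero h' ((hc1 x hx).mono Icc_subset_Ici_self) hzero t ht

end Calculus

/-! ### Integration of `L²`-valued functions -/

section LpIntegral

variable {Ω E : Type*} [MeasurableSpace Ω] {μ : Measure Ω} [IsFiniteMeasure μ]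
  [NormedAddCommGroup E] [NormedSpace ℂ E]

theorem integral_norm_le_of_Lp_two {E : Type*} [NormedAddCommGroup E] (f : Lp E 2 μ) :
    ∫ ω, ‖f ω‖ ∂μ ≤ √(μ.real univ) * ‖f‖ := by
  have h := eLpNorm_le_eLpNorm_mul_rpow_measure_univ (p := 1) (q := 2) (μ := μ) (by norm_num)
    (Lp.aestronglyMeasurable f)
  have h1 : ∫ ω, ‖f ω‖ ∂μ = (eLpNorm f 1 μ).toReal := by
    rw [integral_norm_eq_lintegral_enorm (Lp.aestronglyMeasurable f), eLpNorm_one_eq_lintegral_enorm]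
  rw [h1, Lp.norm_def, mul_comm, Real.sqrt_eq_rpow, Measure.real, ENNReal.toReal_rpow,
    ← ENNReal.toReal_mul]
  refine ENNReal.toReal_mono ?_ (h.trans_eq ?_)
  · exact ENNReal.mul_ne_top (Lp.eLpNorm_ne_top f)
      (ENNReal.rpow_ne_top_of_nonneg (by norm_num) (measure_ne_top μ _))
  · norm_num

/-- The functional `f ↦ ∫ R f` on `L²`, for a bounded operator-valued weight `R` on a finite
measure space. -/
theorem exists_integral_clm {R : Ω → E →L[ℂ] E} {C : ℝ} (hR : AEStronglyMeasurable R μ)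
    (hC : ∀ ω, ‖R ω‖ ≤ C) :
    ∃ P : Lp E 2 μ →L[ℂ] E, (∀ f, P f = ∫ ω, R ω (f ω) ∂μ) ∧
      ∀ f, ‖P f‖ ≤ C * √(μ.real univ) * ‖f‖ := by
  have hint : ∀ f : Lp E 2 μ, Integrable f μ := fun f =>
    (Lp.memLp f).integrable (by norm_num)
  have hRint : ∀ f : Lp E 2 μ, Integrable (fun ω => R ω (f ω)) μ := fun f =>
    Integrable.mono' ((hint f).norm.const_mul C)
      ((ContinuousLinearMap.id ℂ (E →L[ℂ] E)).aestronglyMeasurable_comp₂ hR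
        (Lp.aestronglyMeasurable f))
      (Eventually.of_forall fun ω => ((R ω).le_opNorm _).trans (by gcongr; exact hC ω))
  have hbd : ∀ f : Lp E 2 μ, ‖∫ ω, R ω (f ω) ∂μ‖ ≤ C * √(μ.real univ) * ‖f‖ := by
    intro f
    rcases isEmpty_or_nonempty Ω with h | ⟨⟨ω₀⟩⟩
    · simp [Measure.eq_zero_of_isEmpty μ]
    have hC0 : 0 ≤ C := (norm_nonneg _).trans (hC ω₀)
    calc _ ≤ ∫ ω, C * ‖f ω‖ ∂μ := norm_integral_le_of_norm_le ((hint f).norm.const_mul C)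
          (Eventually.of_forall fun ω => ((R ω).le_opNorm _).trans (by gcongr; exact hC ω))
      _ = C * ∫ ω, ‖f ω‖ ∂μ := integral_const_mul _ _
      _ ≤ C * (√(μ.real univ) * ‖f‖) := by gcongr; exact integral_norm_le_of_Lp_two f
      _ = _ := by ring
  refine ⟨LinearMap.mkContinuous
    { toFun := fun f => ∫ ω, R ω (f ω) ∂μ
      map_add' := fun f g => ?_
      map_smul' := fun c f => ?_ } (C * √(μ.real univ)) hbd, fun f => rfl, hbd⟩
  · rw [← integral_add (hRint f) (hRint g)]
    refine integral_congr_ae ?_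
    filter_upwards [Lp.coeFn_add f g] with ω hω
    rw [hω, Pi.add_apply, map_add]
  · rw [RingHom.id_apply, ← integral_smul]
    refine integral_congr_ae ?_
    filter_upwards [Lp.coeFn_smul c f] with ω hω
    rw [hω, Pi.smul_apply, map_smul]

/-- The Bochner integral of a continuous `L²`-valued function of time is the pointwise integral. -/
theorem coeFn_integral_Lp [CompleteSpace E] {t : ℝ} (ht : 0 ≤ t) {z : ℝ → Lp E 2 μ} {F : ℝ → Ω → E}
    (hF : StronglyMeasurable (Function.uncurry F)) (hz : ∀ s ∈ Icc 0 t, z s =ᵐ[μ] F s)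
    (hc : ContinuousOn z (Icc 0 t)) :
    (∫ s in (0 : ℝ)..t, z s : Lp E 2 μ) =ᵐ[μ] fun ω => ∫ s in (0 : ℝ)..t, F s ω := by
  have hzi : IntervalIntegrable z volume 0 t :=
    (hc.mono (by rw [uIcc_of_le ht])).intervalIntegrable
  obtain ⟨C, hC⟩ := isCompact_Icc.exists_bound_of_continuousOn hc
  have hFi : Integrable (Function.uncurry F) ((volume.restrict (Ioc 0 t)).prod μ) := by
    rw [integrable_prod_iff hF.aestronglyMeasurable]
    constructor
    · filter_upwards [ae_restrict_mem measurableSet_Ioc] with s hs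
      exact ((Lp.memLp (z s)).integrable (by norm_num)).congr (hz s (Ioc_subset_Icc_self hs))
    · refine Integrable.mono' (g := fun _ => √(μ.real univ) * C) (integrable_const _)
        (hF.norm.integral_prod_right (ν := μ)).aestronglyMeasurable ?_
      filter_upwards [ae_restrict_mem measurableSet_Ioc] with s hs
      have hs' := Ioc_subset_Icc_self hs
      have : ∫ ω, ‖Function.uncurry F (s, ω)‖ ∂μ = ∫ ω, ‖z s ω‖ ∂μ :=
        integral_congr_ae ((hz s hs').mono fun ω hω => by simp [hω])
      rw [this, Real.norm_of_nonneg (by positivity)]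
      exact (integral_norm_le_of_Lp_two _).trans (by gcongr; exact hC s hs')
  have hFi2 : Integrable (fun ω => ∫ s in (0 : ℝ)..t, F s ω) μ := by
    simp_rw [intervalIntegral.integral_of_le ht]
    exact hFi.integral_prod_right
  refine Integrable.ae_eq_of_forall_setIntegral_eq _ _
    ((Lp.memLp _).integrable (by norm_num)) hFi2 fun S hS _ => ?_
  obtain ⟨P, hP, -⟩ := exists_integral_clm (μ := μ) (E := E) (C := 1)
    (R := S.indicator fun _ => ContinuousLinearMap.id ℂ E)
    (aestronglyMeasurable_const.indicator hS) (fun ω => by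
      by_cases h : ω ∈ S <;> simp [h, ContinuousLinearMap.norm_id_le])
  have hP' : ∀ f : Lp E 2 μ, P f = ∫ ω in S, f ω ∂μ := fun f => by
    rw [hP, ← integral_indicator hS]
    congr 1
    ext ω
    by_cases h : ω ∈ S <;> simp [h]
  rw [← hP', ← P.intervalIntegral_comp_comm hzi]
  have hsw := integral_integral_swap (f := F) (μ := volume.restrict (Ioc 0 t))
    (ν := μ.restrict S) (hFi.mono_measure (Measure.prod_mono le_rfl Measure.restrict_le_self))
  simp only [intervalIntegral.integral_of_le ht]
  rw [← hsw]
  refine setIntegral_congr_fun measurableSet_Ioc fun s hs => ?_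
  rw [hP']
  exact integral_congr_ae (ae_restrict_of_ae (hz s (Ioc_subset_Icc_self hs)))

end LpIntegral

/-! ### A delay equation -/

section Delay

variable {E : Type*} [NormedAddCommGroup E]

/-- A profile: a measurable function on `ℝ` that is square integrable on every half-line
`(-∞, b)`. -/
structure IsProfile (φ : ℝ → E) : Prop where
  stronglyMeasurable : StronglyMeasurable φ
  memLp : ∀ b, MemLp ((Iio b).indicator φ) 2 volume

theorem IsProfile.intervalIntegrable {φ : ℝ → E} (h : IsProfile φ) (a b : ℝ) :
    IntervalIntegrable φ volume a b := by
  rw [intervalIntegrable_iff]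
  have : IsFiniteMeasure (volume.restrict (uIoc a b)) := by unfold uIoc; infer_instance
  have h1 : MemLp ((Iio (max a b + 1)).indicator φ) 2 (volume.restrict (uIoc a b)) :=
    (h.memLp _).restrict _
  refine (h1.integrable (by norm_num)).congr ?_
  filter_upwards [ae_restrict_mem measurableSet_uIoc] with s hs
  exact indicator_of_mem (mem_Iio.2 (by have := hs.2; grind)) _

theorem IsProfile.comp_sub_right {φ : ℝ → E} (h : IsProfile φ) (c : ℝ) :
    IsProfile fun t => φ (t - c) where
  stronglyMeasurable := h.stronglyMeasurable.comp_measurable (measurable_id.sub_const c)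
  memLp b := by
    have := (h.memLp (b - c)).comp_measurePreserving (measurePreserving_sub_right volume c)
    convert this using 1
    ext1 t
    simp [indicator]

theorem IsProfile.add {φ ψ : ℝ → E} (h : IsProfile φ) (h' : IsProfile ψ) :
    IsProfile fun t => φ t + ψ t where
  stronglyMeasurable := h.stronglyMeasurable.add h'.stronglyMeasurable
  memLp b := by
    have := (h.memLp b).add (h'.memLp b)
    rwa [← indicator_add'] at this

theorem IsProfile.of_memLp {φ : ℝ → E} (hm : StronglyMeasurable φ) (h : MemLp φ 2 volume) :
    IsProfile φ :=
  ⟨hm, fun _ => h.indicator measurableSet_Iio⟩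

theorem IsProfile.isL2loc {φ : ℝ → E} (h : IsProfile φ) : IsL2loc φ := fun T _ => by
  refine ((h.memLp T).restrict (Ioo 0 T)).ae_eq ?_
  filter_upwards [ae_restrict_mem measurableSet_Ioo] with t ht
  exact indicator_of_mem (mem_Iio.2 ht.2) φ

theorem IsProfile.indicator_const (c d : ℝ) (v : E) :
    IsProfile ((Ico c d).indicator fun _ => v) :=
  .of_memLp (stronglyMeasurable_const.indicator measurableSet_Ico)
    (memLp_indicator_const 2 measurableSet_Ico v (Or.inr (by simp)))

/-- A locally square integrable input agrees a.e. on `(0, ∞)` with a profile supported there. -/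
theorem exists_profile_of_isL2loc {u : ℝ → E} (hu : IsL2loc u) :
    ∃ v : ℝ → E, IsProfile v ∧ (∀ t ≤ 0, v t = 0) ∧ ∀ᵐ t, 0 < t → v t = u t := by
  have hm : AEStronglyMeasurable u (volume.restrict (Ioi 0)) := by
    have : Ioi (0 : ℝ) = ⋃ k : ℕ, Ioo (0 : ℝ) (k + 1) := by
      ext t
      simp only [mem_Ioi, mem_iUnion, mem_Ioo]
      refine ⟨fun h => ?_, fun ⟨k, hk⟩ => hk.1⟩
      obtain ⟨k, hk⟩ := exists_nat_gt t
      exact ⟨k, h, by linarith⟩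
    rw [this, aestronglyMeasurable_iUnion_iff]
    exact fun k => (hu (k + 1) (by positivity)).aestronglyMeasurable
  have hae : ∀ᵐ t, t ∈ Ioi (0 : ℝ) → (Ioi 0).indicator (hm.mk u) t = u t := by
    rw [← ae_restrict_iff' measurableSet_Ioi]
    filter_upwards [hm.ae_eq_mk, ae_restrict_mem measurableSet_Ioi] with t h1 h2
    rw [indicator_of_mem h2, h1]
  refine ⟨(Ioi 0).indicator (hm.mk u), ⟨hm.stronglyMeasurable_mk.indicator measurableSet_Ioi,
    fun b => ?_⟩, fun t ht => indicator_of_notMem (not_lt.2 ht) _, hae⟩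
  rcases le_or_gt b 0 with hb | hb
  · have : (Iio b).indicator ((Ioi 0).indicator (hm.mk u)) = 0 := by
      ext1 t
      rw [indicator_indicator]
      exact indicator_of_notMem (fun h => absurd (lt_trans h.2 h.1) (not_lt.2 hb)) _
    rw [this]
    exact MemLp.zero
  · have h2 : MemLp ((Ioo 0 b).indicator u) 2 volume :=
      (memLp_indicator_iff_restrict measurableSet_Ioo).2 (hu b hb)
    refine h2.ae_eq ?_
    filter_upwards [hae] with t ht
    by_cases h0 : 0 < t <;> by_cases hb : t < b <;> simp [indicator, h0, hb, ← ht]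

theorem IsProfile.sum {ι : Type*} (s : Finset ι) {φ : ι → ℝ → E} (h : ∀ i ∈ s, IsProfile (φ i)) :
    IsProfile fun t => ∑ i ∈ s, φ i t where
  stronglyMeasurable := Finset.stronglyMeasurable_fun_sum s fun i hi => (h i hi).stronglyMeasurable
  memLp b := by
    have := memLp_finsetSum s fun i hi => (h i hi).memLp b
    convert this using 1
    ext1 t
    by_cases ht : t < b <;> simp [ht]

variable [NormedSpace ℂ E]

theorem IsProfile.clm_comp {F : Type*} [NormedAddCommGroup F] [NormedSpace ℂ F] {φ : ℝ → E}
    (h : IsProfile φ) (A : E →L[ℂ] F) :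
    IsProfile fun t => A (φ t) where
  stronglyMeasurable := A.continuous.comp_stronglyMeasurable h.stronglyMeasurable
  memLp b := by
    have := A.comp_memLp' (h.memLp b)
    convert this using 1
    ext1 t
    by_cases ht : t < b <;> simp [ht]

/-- The delay equation `φ(t) = f(t) + A φ(t - T)` is solved by `∑ⱼ Aʲ f(t - j T)`, a sum that is
finite on each half-line `(-∞, b)` because `f` vanishes before `-T`. -/
theorem exists_profile_delay {T : ℝ} (hT : 0 < T) (A : E →L[ℂ] E) {f : ℝ → E} (hf : IsProfile f)
    (h0 : ∀ t < -T, f t = 0) :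
    ∃ φ : ℝ → E, IsProfile φ ∧ (∀ t < -T, φ t = 0) ∧ ∀ t, φ t = f t + A (φ (t - T)) := by
  set S : ℕ → ℝ → E := fun N t => ∑ j ∈ Finset.range N, (A ^ j) (f (t - j * T)) with hS
  have hSp : ∀ N, IsProfile (S N) := fun N =>
    IsProfile.sum _ fun j _ => (hf.comp_sub_right (j * T)).clm_comp (A ^ j)
  set φ : ℝ → E := fun t => ∑' j : ℕ, (A ^ j) (f (t - j * T)) with hφ
  have hval : ∀ (N : ℕ) t, t < N * T - T → φ t = S N t := fun N t ht =>
    tsum_eq_sum fun j hj => by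
      rw [h0, map_zero]
      have : (N : ℝ) ≤ j := by exact_mod_cast not_lt.1 (by simpa using hj)
      nlinarith
  have hex : ∀ t : ℝ, ∃ N : ℕ, t < N * T - T := fun t => by
    obtain ⟨N, hN⟩ := exists_nat_gt ((t + T) / T)
    exact ⟨N, by rw [div_lt_iff₀ hT] at hN; linarith⟩
  refine ⟨φ, ⟨?_, fun b => ?_⟩, fun t ht => ?_, fun t => ?_⟩
  · refine stronglyMeasurable_of_tendsto atTop (fun N => (hSp N).stronglyMeasurable) ?_
    rw [tendsto_pi_nhds]
    intro t
    obtain ⟨N, hN⟩ := hex t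
    refine tendsto_const_nhds.congr' ?_
    filter_upwards [eventually_ge_atTop N] with k hk
    refine hval k t (hN.trans_le ?_)
    have : (N : ℝ) ≤ k := by exact_mod_cast hk
    nlinarith
  · obtain ⟨N, hN⟩ := hex b
    have : (Iio b).indicator φ = (Iio b).indicator (S N) :=
      indicator_congr fun t ht => hval N t (lt_trans ht hN)
    rw [this]
    exact (hSp N).memLp b
  · rw [hval 0 t (by simpa using ht)]
    simp [hS]
  · obtain ⟨N, hN⟩ := hex t
    rw [hval (N + 1) t (by push_cast; linarith), hval N (t - T) (by linarith), hS]
    simp only [Finset.sum_range_succ', map_sum]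
    rw [add_comm]
    congr 1
    · simp
    · refine Finset.sum_congr rfl fun j _ => ?_
      rw [pow_succ']
      simp only [mul_apply_eq_comp]
      congr 3
      push_cast
      ring

end Delay

/-! ### Linear differential equations with bounded measurable coefficients -/

/-- Existence for `f' = A f`, `f(0) = y₀` on `[0, 1]` in integrated form. The coefficient is merely
bounded and measurable, which the Picard–Lindelöf theorem does not cover. -/
theorem exists_linear_ode {Y : Type*} [NormedAddCommGroup Y] [NormedSpace ℂ Y] [CompleteSpace Y]
    {A : ℝ → Y →L[ℂ] Y} {C : ℝ} (hA : AEStronglyMeasurable A spaceMeasure)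
    (hC : ∀ᵐ ζ ∂spaceMeasure, ‖A ζ‖ ≤ C) (y₀ : Y) :
    ∃ f : ℝ → Y, Continuous f ∧
      ∀ ζ ∈ Icc (0 : ℝ) 1, f ζ = y₀ + ∫ s in (0 : ℝ)..ζ, A s (f s) := by
  set D : ℝ := max C 0 with hD
  have hD0 : 0 ≤ D := le_max_right _ _
  set k : ℝ := 2 * D + 1 with hk
  have hk0 : 0 < k := by positivity
  set A' : ℝ → Y →L[ℂ] Y := (Ioo 0 1).indicator A with hA'
  have hA'm : AEStronglyMeasurable A' volume := 
    (aestronglyMeasurable_indicator_iff measurableSet_Ioo).2 hA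
  have hA'b : ∀ᵐ ζ, ‖A' ζ‖ ≤ (Ioo (0 : ℝ) 1).indicator (fun _ => D) ζ := by
    filter_upwards [(ae_restrict_iff' measurableSet_Ioo).1 hC] with ζ hζ
    by_cases h : ζ ∈ Ioo (0 : ℝ) 1
    · simp only [hA', indicator_of_mem h]
      exact (hζ h).trans (le_max_left _ _)
    · simp [hA', h]
  -- clamping to `[0, 1]`, so that the fixed point problem lives on bounded functions on `ℝ`
  let cl : ℝ → ℝ := fun ζ => max 0 (min 1 ζ)
  have hcl : Continuous cl := by fun_prop
  have hcl0 : ∀ ζ, 0 ≤ cl ζ := fun ζ => le_max_left _ _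
  have hcl1 : ∀ ζ, cl ζ ≤ 1 := fun ζ => max_le zero_le_one (min_le_left _ _)
  have hcli : ∀ ζ ∈ Icc (0 : ℝ) 1, cl ζ = ζ := fun ζ hζ => by
    simp only [cl]; rw [min_eq_right hζ.2, max_eq_right hζ.1]
  -- The unknown is `f(ζ) = exp(k ζ) h(ζ)`; since `k > 2 D`, the fixed point map for `h` is a
  -- contraction with constant `1 / 2` on the whole interval.
  let I : (ℝ → Y) → ℝ → Y := fun f x => Real.exp (k * x) • A' x (f x)
  have hIb : ∀ (f : ℝ → Y) (B : ℝ), (∀ x, ‖f x‖ ≤ B) → ∀ᵐ x,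
      ‖I f x‖ ≤ Real.exp (k * x) * (D * B) := by
    intro f B hB
    filter_upwards [hA'b] with x hx
    simp only [I]
    rw [norm_smul, Real.norm_of_nonneg (Real.exp_pos _).le]
    have hB0 : 0 ≤ B := (norm_nonneg _).trans (hB x)
    have : (Ioo (0 : ℝ) 1).indicator (fun _ => D) x ≤ D :=
      indicator_le_self' (fun _ _ => hD0) x
    gcongr
    exact ((A' x).le_opNorm _).trans (mul_le_mul (hx.trans this) (hB x) (norm_nonneg _) hD0)
  have hIi : ∀ (f : ℝ → Y) (B : ℝ), Continuous f → (∀ x, ‖f x‖ ≤ B) → ∀ a b,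
      IntervalIntegrable (I f) volume a b := by
    intro f B hf hB a b
    have hg : IntervalIntegrable (fun x => Real.exp (k * x) * (D * B)) volume a b :=
      (by fun_prop : Continuous fun x => Real.exp (k * x) * (D * B)).intervalIntegrable a b
    refine hg.mono_fun' ?_ (ae_restrict_of_ae (hIb f B hB))
    refine AEStronglyMeasurable.restrict ?_
    exact (by fun_prop : Continuous fun x => Real.exp (k * x)).aestronglyMeasurable.smul
      ((ContinuousLinearMap.id ℂ (Y →L[ℂ] Y)).aestronglyMeasurable_comp₂ hA'm
        hf.aestronglyMeasurable)
  have hIest : ∀ (f : ℝ → Y) (B : ℝ), (∀ x, ‖f x‖ ≤ B) → ∀ s, 0 ≤ s →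
      ‖Real.exp (-(k * s)) • ∫ x in (0 : ℝ)..s, I f x‖ ≤ B / 2 := by
    intro f B hB s hs
    have hB0 : 0 ≤ B := (norm_nonneg _).trans (hB 0)
    have h1 : ‖∫ x in (0 : ℝ)..s, I f x‖ ≤ ∫ x in (0 : ℝ)..s, Real.exp (k * x) * (D * B) :=
      intervalIntegral.norm_integral_le_of_norm_le hs
        ((hIb f B hB).mono fun x hx _ => hx)
        ((by fun_prop : Continuous fun x => Real.exp (k * x) * (D * B)).intervalIntegrable _ _)
    have h2 : ∫ x in (0 : ℝ)..s, Real.exp (k * x) * (D * B) =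
        k⁻¹ * (Real.exp (k * s) - 1) * (D * B) := by
      rw [intervalIntegral.integral_mul_const,
        intervalIntegral.integral_comp_mul_left (fun x => Real.exp x) hk0.ne', integral_exp]
      simp
    rw [h2] at h1
    rw [norm_smul, Real.norm_of_nonneg (Real.exp_pos _).le]
    calc _ ≤ Real.exp (-(k * s)) * (k⁻¹ * (Real.exp (k * s) - 1) * (D * B)) := by gcongr
      _ = (1 - Real.exp (-(k * s))) * (k⁻¹ * D) * B := by
          have : Real.exp (-(k * s)) * Real.exp (k * s) = 1 := by rw [← Real.exp_add]; simp
          linear_combination k⁻¹ * D * B * this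
      _ ≤ 1 * (1 / 2) * B := by
          gcongr
          · linarith [Real.exp_pos (-(k * s))]
          · rw [inv_mul_le_iff₀ hk0]; linarith
      _ = B / 2 := by ring
  have hTc : ∀ f : BoundedContinuousFunction ℝ Y, Continuous fun ζ =>
      Real.exp (-(k * cl ζ)) • y₀ + Real.exp (-(k * cl ζ)) • ∫ x in (0 : ℝ)..cl ζ, I f x := by
    intro f
    have hp : Continuous fun s => ∫ x in (0 : ℝ)..s, I f x :=
      intervalIntegral.continuous_primitive
        (fun a b => hIi f ‖f‖ f.continuous f.norm_coe_le_norm a b) 0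
    have := hp.comp hcl
    simp only [Function.comp_def] at this
    fun_prop
  let T : BoundedContinuousFunction ℝ Y → BoundedContinuousFunction ℝ Y := fun f =>
    BoundedContinuousFunction.ofNormedAddCommGroup _ (hTc f) (‖y₀‖ + ‖f‖ / 2) (fun ζ => by
      refine (norm_add_le _ _).trans (add_le_add ?_
        (hIest f ‖f‖ f.norm_coe_le_norm _ (hcl0 ζ)))
      rw [norm_smul, Real.norm_of_nonneg (Real.exp_pos _).le]
      refine mul_le_of_le_one_left (norm_nonneg _) (Real.exp_le_one_iff.2 ?_)
      have := mul_nonneg hk0.le (hcl0 ζ)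
      linarith)
  have hT : ContractingWith (1 / 2) T := by
    refine ⟨by norm_num, LipschitzWith.of_dist_le_mul fun f g => ?_⟩
    rw [BoundedContinuousFunction.dist_le (by positivity)]
    intro ζ
    have e : T f ζ - T g ζ = Real.exp (-(k * cl ζ)) • ∫ x in (0 : ℝ)..cl ζ, I (f - g) x := by
      have : ∫ x in (0 : ℝ)..cl ζ, I (f - g) x =
          (∫ x in (0 : ℝ)..cl ζ, I f x) - ∫ x in (0 : ℝ)..cl ζ, I g x := by
        rw [← intervalIntegral.integral_sub
          (hIi f ‖f‖ f.continuous f.norm_coe_le_norm _ _)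
          (hIi g ‖g‖ g.continuous g.norm_coe_le_norm _ _)]
        simp [I, smul_sub]
      rw [this, smul_sub]
      simp only [T, BoundedContinuousFunction.coe_ofNormedAddCommGroup]
      abel
    rw [dist_eq_norm, e]
    refine (hIest _ (dist f g) (fun x => ?_) _ (hcl0 ζ)).trans_eq ?_
    · rw [Pi.sub_apply, ← dist_eq_norm]
      exact BoundedContinuousFunction.dist_coe_le_dist x
    · push_cast; ring
  obtain ⟨h, hfix⟩ : ∃ h, T h = h := ⟨hT.fixedPoint, hT.fixedPoint_isFixedPt⟩
  refine ⟨fun ζ => Real.exp (k * cl ζ) • h ζ, by fun_prop, fun ζ hζ => ?_⟩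
  have h1 : h ζ = Real.exp (-(k * cl ζ)) • y₀ +
      Real.exp (-(k * cl ζ)) • ∫ x in (0 : ℝ)..cl ζ, I h x := by
    conv_lhs => rw [← hfix]
    rfl
  simp only
  rw [h1, ← smul_add, smul_smul, ← Real.exp_add, add_neg_cancel, Real.exp_zero, one_smul,
    hcli ζ hζ]
  congr 1
  refine intervalIntegral.integral_congr_ae ?_
  have hne : ∀ᵐ x : ℝ, x ≠ 1 := by simp [ae_iff]
  filter_upwards [hne] with x hx hx'
  rw [uIoc_of_le hζ.1] at hx'
  have hx1 : x ≤ 1 := hx'.2.trans hζ.2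
  have hx2 : x ∈ Ioo (0 : ℝ) 1 := ⟨hx'.1, lt_of_le_of_ne hx1 hx⟩
  simp only [I, hA', indicator_of_mem hx2, hcli x ⟨hx'.1.le, hx1⟩]
  rw [← Complex.coe_smul, ← Complex.coe_smul, map_smul]

/-! ### The travel time as a coordinate -/

/-- A slowness `r = 1 / lam`: a measurable function on `ℝ` with `0 < a ≤ r ≤ b` everywhere. -/
structure IsSlowness (r : ℝ → ℝ) (a b : ℝ) : Prop where
  measurable : Measurable r
  pos : 0 < a
  le : ∀ ζ, a ≤ r ζ
  ge : ∀ ζ, r ζ ≤ b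

/-- The time a signal needs to travel from `0` to `ζ`. -/
def travelTime (r : ℝ → ℝ) (ζ : ℝ) : ℝ := ∫ s in (0 : ℝ)..ζ, r s

@[simp]
theorem travelTime_zero (r : ℝ → ℝ) : travelTime r 0 = 0 := by
  simp [travelTime]

/-- The measure with density `r`; the travel time maps it to Lebesgue measure. -/
def slownessMeasure (r : ℝ → ℝ) : Measure ℝ :=
  volume.withDensity fun ζ => ((r ζ).toNNReal : ENNReal)

namespace IsSlowness

variable {r : ℝ → ℝ} {a b : ℝ}

theorem pos_apply (hr : IsSlowness r a b) (ζ : ℝ) : 0 < r ζ := hr.pos.trans_le (hr.le ζ)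

theorem intervalIntegrable (hr : IsSlowness r a b) (x y : ℝ) : IntervalIntegrable r volume x y :=
  (intervalIntegrable_const (c := b)).mono_fun' hr.measurable.aestronglyMeasurable
    (Eventually.of_forall fun ζ => by
      simpa [abs_of_pos (hr.pos_apply ζ)] using hr.ge ζ)

theorem travelTime_sub (hr : IsSlowness r a b) (x y : ℝ) :
    travelTime r y - travelTime r x = ∫ s in x..y, r s :=
  intervalIntegral.integral_interval_sub_left (hr.intervalIntegrable _ _)
    (hr.intervalIntegrable _ _)

theorem le_travelTime_sub (hr : IsSlowness r a b) {x y : ℝ} (h : x ≤ y) :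
    a * (y - x) ≤ travelTime r y - travelTime r x := by
  rw [hr.travelTime_sub]
  have := intervalIntegral.integral_mono_on h (intervalIntegrable_const (c := a))
    (hr.intervalIntegrable x y) fun s _ => hr.le s
  rw [intervalIntegral.integral_const, smul_eq_mul] at this
  linarith

theorem strictMono (hr : IsSlowness r a b) : StrictMono (travelTime r) := fun x y h => by
  have := hr.le_travelTime_sub h.le
  have := mul_pos hr.pos (sub_pos.2 h)
  linarith

theorem continuous (hr : IsSlowness r a b) : Continuous (travelTime r) :=
  intervalIntegral.continuous_primitive (fun x y => hr.intervalIntegrable x y) 0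

theorem surjective (hr : IsSlowness r a b) : Function.Surjective (travelTime r) := by
  refine hr.continuous.surjective ?_ ?_
  · refine tendsto_atTop_mono' atTop ?_ (tendsto_id.const_mul_atTop hr.pos)
    filter_upwards [eventually_ge_atTop 0] with x hx
    have := hr.le_travelTime_sub hx
    rw [travelTime_zero r] at this
    simpa using this
  · refine tendsto_atBot_mono' atBot ?_ (tendsto_id.const_mul_atBot hr.pos)
    filter_upwards [eventually_le_atBot 0] with x hx
    have := hr.le_travelTime_sub hx
    rw [travelTime_zero r] at this
    simp only [id]
    linarith

theorem travelTime_one_pos (hr : IsSlowness r a b) : 0 < travelTime r 1 := by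
  simpa using hr.strictMono zero_lt_one

theorem travelTime_mem_Icc (hr : IsSlowness r a b) {ζ : ℝ} (hζ : ζ ∈ Icc (0 : ℝ) 1) :
    travelTime r ζ ∈ Icc 0 (travelTime r 1) :=
  ⟨travelTime_zero r ▸ hr.strictMono.monotone hζ.1, hr.strictMono.monotone hζ.2⟩

theorem travelTime_mem_Ioo (hr : IsSlowness r a b) {ζ : ℝ} (hζ : ζ ∈ Ioo (0 : ℝ) 1) :
    travelTime r ζ ∈ Ioo 0 (travelTime r 1) :=
  ⟨travelTime_zero r ▸ hr.strictMono hζ.1, hr.strictMono hζ.2⟩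

theorem slownessMeasure_le_smul (hr : IsSlowness r a b) :
    slownessMeasure r ≤ ENNReal.ofReal b • volume := by
  rw [slownessMeasure, ← withDensity_const]
  exact withDensity_mono (Eventually.of_forall fun ζ => ENNReal.ofReal_le_ofReal (hr.ge ζ))

theorem volume_le_smul (hr : IsSlowness r a b) :
    (volume : Measure ℝ) ≤ (ENNReal.ofReal a)⁻¹ • slownessMeasure r := by
  have h1 : ENNReal.ofReal a • (volume : Measure ℝ) ≤ slownessMeasure r := by
    rw [slownessMeasure, ← withDensity_const]
    exact withDensity_mono (Eventually.of_forall fun ζ => ENNReal.ofReal_le_ofReal (hr.le ζ))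
  have h2 : (ENNReal.ofReal a)⁻¹ • ENNReal.ofReal a • (volume : Measure ℝ) ≤
      (ENNReal.ofReal a)⁻¹ • slownessMeasure r := by gcongr
  rwa [smul_smul, ENNReal.inv_mul_cancel (by simpa using hr.pos) ENNReal.ofReal_ne_top,
    one_smul] at h2

theorem isLocallyFiniteMeasure (hr : IsSlowness r a b) :
    IsLocallyFiniteMeasure (slownessMeasure r) := by
  refine ⟨fun x => ⟨Ioo (x - 1) (x + 1), Ioo_mem_nhds (by linarith) (by linarith), ?_⟩⟩
  refine (hr.slownessMeasure_le_smul _).trans_lt ?_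
  simp only [Measure.smul_apply, Real.volume_Ioo, smul_eq_mul]
  exact ENNReal.mul_lt_top ENNReal.ofReal_lt_top ENNReal.ofReal_lt_top

/-- The travel time as a homeomorphism of the line. -/
theorem exists_homeomorph (hr : IsSlowness r a b) : ∃ e : ℝ ≃ₜ ℝ, ⇑e = travelTime r :=
  ⟨(hr.strictMono.orderIsoOfSurjective _ hr.surjective).toHomeomorph, rfl⟩

theorem measurePreserving (hr : IsSlowness r a b) :
    MeasurePreserving (travelTime r) (slownessMeasure r) volume := by
  refine ⟨hr.continuous.measurable, ?_⟩
  symm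
  refine Real.measure_ext_Ioo_rat fun p q => ?_
  rw [Measure.map_apply hr.continuous.measurable measurableSet_Ioo]
  obtain ⟨x, hx⟩ := hr.surjective p
  obtain ⟨y, hy⟩ := hr.surjective q
  have hpre : travelTime r ⁻¹' Ioo (p : ℝ) q = Ioo x y := by
    ext ζ
    simp only [mem_preimage, mem_Ioo, ← hx, ← hy, hr.strictMono.lt_iff_lt]
  rw [hpre, slownessMeasure, withDensity_apply _ measurableSet_Ioo, Real.volume_Ioo, ← hx, ← hy]
  rcases le_total y x with h | h
  · rw [Ioo_eq_empty (not_lt.2 h), ENNReal.ofReal_of_nonpos]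
    · simp
    · linarith [hr.strictMono.monotone h]
  · rw [hr.travelTime_sub, intervalIntegral.integral_of_le h, integral_Ioc_eq_integral_Ioo,
      ofReal_integral_eq_lintegral_ofReal]
    · rfl
    · exact ((hr.intervalIntegrable x y).1).mono_set Ioo_subset_Ioc_self
    · exact Eventually.of_forall fun ζ => (hr.pos_apply ζ).le

theorem measurePreserving_sub (hr : IsSlowness r a b) (t : ℝ) :
    MeasurePreserving (fun ζ => t - travelTime r ζ) (slownessMeasure r) volume :=
  (Measure.measurePreserving_sub_left volume t).comp hr.measurePreserving

variable {E : Type*} [NormedAddCommGroup E]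

theorem memLp_comp (hr : IsSlowness r a b) {ψ : ℝ → E} (hψ : MemLp ψ 2 volume) (t : ℝ) :
    MemLp (fun ζ => ψ (t - travelTime r ζ)) 2 volume :=
  (hψ.comp_measurePreserving (hr.measurePreserving_sub t)).of_measure_le_smul
    (ENNReal.inv_ne_top.2 (by simpa using hr.pos)) hr.volume_le_smul

variable [NormedSpace ℝ E]

theorem intervalIntegrable_comp (hr : IsSlowness r a b) {f : ℝ → E} {x y : ℝ} (h : x ≤ y)
    (hf : IntervalIntegrable f volume (travelTime r x) (travelTime r y)) :
    IntervalIntegrable (fun s => r s • f (travelTime r s)) volume x y := by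
  obtain ⟨e, he⟩ := hr.exists_homeomorph
  have hemb : MeasurableEmbedding (travelTime r) := he ▸ e.measurableEmbedding
  have hpre : travelTime r ⁻¹' Ioc (travelTime r x) (travelTime r y) = Ioc x y := by
    ext ζ
    simp only [mem_preimage, mem_Ioc, hr.strictMono.lt_iff_lt, hr.strictMono.le_iff_le]
  rw [intervalIntegrable_iff_integrableOn_Ioc_of_le (hr.strictMono.monotone h)] at hf
  rw [intervalIntegrable_iff_integrableOn_Ioc_of_le h]
  rw [← hr.measurePreserving.integrableOn_comp_preimage hemb, hpre, slownessMeasure, IntegrableOn,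
    restrict_withDensity measurableSet_Ioc,
    integrable_withDensity_iff_integrable_smul hr.measurable.real_toNNReal] at hf
  refine hf.congr (Eventually.of_forall fun s => ?_)
  simp [NNReal.smul_def, (hr.pos_apply s).le]

theorem integral_comp (hr : IsSlowness r a b) (f : ℝ → E) {x y : ℝ} (h : x ≤ y) :
    ∫ s in x..y, r s • f (travelTime r s) = ∫ s in travelTime r x..travelTime r y, f s := by
  obtain ⟨e, he⟩ := hr.exists_homeomorph
  have hemb : MeasurableEmbedding (travelTime r) := he ▸ e.measurableEmbedding
  have hpre : travelTime r ⁻¹' Ioc (travelTime r x) (travelTime r y) = Ioc x y := by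
    ext ζ
    simp only [mem_preimage, mem_Ioc, hr.strictMono.lt_iff_lt, hr.strictMono.le_iff_le]
  rw [intervalIntegral.integral_of_le h, intervalIntegral.integral_of_le
    (hr.strictMono.monotone h), ← hr.measurePreserving.setIntegral_preimage_emb hemb f, hpre,
    slownessMeasure,
    setIntegral_withDensity_eq_setIntegral_smul hr.measurable.real_toNNReal _ measurableSet_Ioc]
  refine integral_congr_ae (Eventually.of_forall fun s => ?_)
  simp [NNReal.smul_def, (hr.pos_apply s).le]

end IsSlowness

theorem ae_norm_le_of_memLp_top {E : Type*} [NormedAddCommGroup E] {f : ℝ → E}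
    (hf : MemLp f ⊤ spaceMeasure) : ∃ C, ∀ᵐ ζ ∂spaceMeasure, ‖f ζ‖ ≤ C := by
  have h := hf.eLpNorm_lt_top.ne
  rw [eLpNorm_exponent_top] at h
  refine ⟨(eLpNormEssSup f spaceMeasure).toReal, ?_⟩
  filter_upwards [ae_le_eLpNormEssSup (f := f) (μ := spaceMeasure)] with ζ hζ
  rw [← toReal_enorm]
  exact ENNReal.toReal_mono h hζ

/-- An essentially bounded function that is essentially bounded below by a positive constant has
a slowness as its reciprocal. -/
theorem exists_slowness {lam : ℝ → ℝ} (hlam : MemLp lam ⊤ spaceMeasure)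
    (hpos : ∃ ε : ℝ, 0 < ε ∧ ∀ᵐ ζ ∂spaceMeasure, ε ≤ lam ζ) :
    ∃ r a b, IsSlowness r a b ∧ ∀ᵐ ζ ∂spaceMeasure, r ζ * lam ζ = 1 := by
  obtain ⟨ε, hε, hle⟩ := hpos
  obtain ⟨C, hC⟩ := ae_norm_le_of_memLp_top hlam
  set D := max C ε with hD
  have hD0 : 0 < D := hε.trans_le (le_max_right _ _)
  have hm := hlam.aestronglyMeasurable
  refine ⟨fun ζ => (max ε (min D (hm.mk lam ζ)))⁻¹, D⁻¹, ε⁻¹, ⟨?_, by positivity, fun ζ => ?_,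
    fun ζ => ?_⟩, ?_⟩
  · exact (measurable_const.max (measurable_const.min hm.stronglyMeasurable_mk.measurable)).inv
  · exact inv_anti₀ (hε.trans_le (le_max_left _ _)) (max_le (le_max_right _ _) (min_le_left _ _))
  · exact inv_anti₀ hε (le_max_left _ _)
  · filter_upwards [hm.ae_eq_mk, hle, hC] with ζ h1 h2 h3
    rw [← h1, min_eq_right, max_eq_right h2, inv_mul_cancel₀ (hε.trans_le h2).ne']
    exact (le_abs_self _).trans (h3.trans (le_max_left _ _))

/-! ### The fundamental matrix -/

/-- The coefficient `r M` of the ordinary differential equation along characteristics. -/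
def odeCoeff {n : ℕ} (r : ℝ → ℝ) (M : ℝ → Matrix (Fin n) (Fin n) ℂ) (ζ : ℝ) :
    EuclideanSpace ℂ (Fin n) →L[ℂ] EuclideanSpace ℂ (Fin n) :=
  (r ζ : ℂ) • Matrix.toEuclideanCLM (𝕜 := ℂ) (M ζ)

theorem odeCoeff_apply {n : ℕ} (r : ℝ → ℝ) (M : ℝ → Matrix (Fin n) (Fin n) ℂ) (ζ : ℝ)
    (x : EuclideanSpace ℂ (Fin n)) :
    odeCoeff r M ζ x = r ζ • (M ζ).toEuclideanLin x := by
  rw [odeCoeff, smul_apply, Complex.coe_smul]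
  rfl

/-- `Q` solves `Q' = A Q`, `Q 0 = 1` on `[0, 1]`, and `R = Q⁻¹` solves `R' = -R A`. -/
structure IsFundamental {E : Type*} [NormedAddCommGroup E] [NormedSpace ℂ E]
    (A Q R : ℝ → E →L[ℂ] E) : Prop where
  continuous_Q : Continuous Q
  continuous_R : Continuous R
  Q_zero : Q 0 = 1
  R_zero : R 0 = 1
  Q_eq : ∀ ζ ∈ Icc (0 : ℝ) 1, Q ζ = 1 + ∫ s in (0 : ℝ)..ζ, A s * Q s
  R_eq : ∀ ζ ∈ Icc (0 : ℝ) 1, R ζ = 1 + ∫ s in (0 : ℝ)..ζ, -(R s * A s)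
  R_mul_Q : ∀ ζ ∈ Icc (0 : ℝ) 1, R ζ * Q ζ = 1
  Q_mul_R : ∀ ζ ∈ Icc (0 : ℝ) 1, Q ζ * R ζ = 1
  intervalIntegrable : IntervalIntegrable A volume 0 1

theorem memLp_top_linearMap_matrix {n : ℕ} {V : Type*} [NormedAddCommGroup V] [NormedSpace ℂ V]
    {M : ℝ → Matrix (Fin n) (Fin n) ℂ} (hM : ∀ i j, MemLp (fun ζ => M ζ i j) ⊤ spaceMeasure)
    (Φ : Matrix (Fin n) (Fin n) ℂ →ₗ[ℂ] V) : MemLp (fun ζ => Φ (M ζ)) ⊤ spaceMeasure := by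
  have h : ∀ ζ, Φ (M ζ) = ∑ i, ∑ j, M ζ i j • Φ (Matrix.single i j 1) := fun ζ => by
    conv_lhs => rw [Matrix.matrix_eq_sum_single (M ζ)]
    rw [map_sum]
    refine Finset.sum_congr rfl fun i _ => ?_
    rw [map_sum]
    refine Finset.sum_congr rfl fun j _ => ?_
    rw [← map_smul, Matrix.smul_single, smul_eq_mul, mul_one]
  simp_rw [h]
  refine memLp_finsetSum _ fun i _ => memLp_finsetSum _ fun j _ => ?_
  exact ((ContinuousLinearMap.id ℂ ℂ).smulRight (Φ (Matrix.single i j 1))).comp_memLp' (hM i j)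

theorem memLp_odeCoeff {n : ℕ} {r : ℝ → ℝ} {a b : ℝ} (hr : IsSlowness r a b)
    {M : ℝ → Matrix (Fin n) (Fin n) ℂ} (hM : ∀ i j, MemLp (fun ζ => M ζ i j) ⊤ spaceMeasure) :
    MemLp (odeCoeff r M) ⊤ spaceMeasure := by
  have hM' : MemLp (fun ζ => Matrix.toEuclideanCLM (𝕜 := ℂ) (M ζ)) ⊤ spaceMeasure :=
    memLp_top_linearMap_matrix hM
      (Matrix.toEuclideanCLM (𝕜 := ℂ) (n := Fin n)).toAlgEquiv.toLinearMap
  obtain ⟨C, hC⟩ := ae_norm_le_of_memLp_top hM'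
  refine memLp_top_of_bound ?_ (b * C) ?_
  · exact (Complex.measurable_ofReal.comp hr.measurable).aestronglyMeasurable.smul
      hM'.aestronglyMeasurable
  · filter_upwards [hC] with ζ hζ
    rw [odeCoeff, norm_smul, Complex.norm_real, Real.norm_of_nonneg (hr.pos_apply ζ).le]
    exact mul_le_mul (hr.ge ζ) hζ (norm_nonneg _) ((hr.pos_apply ζ).le.trans (hr.ge ζ))

theorem intervalIntegrable_zero_one_of_integrable {E : Type*} [NormedAddCommGroup E] {f : ℝ → E}
    (hf : Integrable f spaceMeasure) : IntervalIntegrable f volume 0 1 := by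
  rwa [intervalIntegrable_iff_integrableOn_Ioo_of_le zero_le_one]

theorem exists_isFundamental {E : Type*} [NormedAddCommGroup E] [NormedSpace ℂ E]
    [FiniteDimensional ℂ E] {A : ℝ → E →L[ℂ] E} (hA : MemLp A ⊤ spaceMeasure) :
    ∃ Q R : ℝ → E →L[ℂ] E, IsFundamental A Q R := by
  have : CompleteSpace E := FiniteDimensional.complete ℂ E
  obtain ⟨C, hC⟩ := ae_norm_le_of_memLp_top hA
  set L := ContinuousLinearMap.mul ℂ (E →L[ℂ] E) with hL
  have hLn : ∀ T : E →L[ℂ] E, ‖L T‖ ≤ ‖T‖ := fun T =>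
    ContinuousLinearMap.opNorm_mul_apply_le ℂ (E →L[ℂ] E) T
  obtain ⟨Q, hQc, hQ⟩ := exists_linear_ode (A := fun ζ => L (A ζ)) (C := C)
    (L.continuous.comp_aestronglyMeasurable hA.aestronglyMeasurable)
    (hC.mono fun ζ hζ => (hLn _).trans hζ) (1 : E →L[ℂ] E)
  obtain ⟨R, hRc, hR⟩ := exists_linear_ode (A := fun ζ => L.flip (-A ζ)) (C := ‖L.flip‖ * C)
    (L.flip.continuous.comp_aestronglyMeasurable hA.aestronglyMeasurable.neg)
    (hC.mono fun ζ hζ => (L.flip.le_opNorm _).trans (by rw [norm_neg]; gcongr)) (1 : E →L[ℂ] E)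
  have hAi : IntervalIntegrable A volume 0 1 :=
    intervalIntegrable_zero_one_of_integrable (hA.integrable le_top)
  have hAQ : IntervalIntegrable (fun s => A s * Q s) volume 0 1 :=
    hAi.bilin_continuousOn L hQc.continuousOn
  have hRA : IntervalIntegrable (fun s => -(R s * A s)) volume 0 1 :=
    (hAi.bilin_continuousOn L.flip hRc.continuousOn).neg
  have hQ0 : Q 0 = 1 := by simpa using hQ 0 (by simp)
  have hR0 : R 0 = 1 := by simpa using hR 0 (by simp)
  have hQ' : ∀ ζ ∈ Icc (0 : ℝ) 1, Q ζ = 1 + ∫ s in (0 : ℝ)..ζ, A s * Q s := hQ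
  have hR' : ∀ ζ ∈ Icc (0 : ℝ) 1, R ζ = 1 + ∫ s in (0 : ℝ)..ζ, -(R s * A s) := by
    intro ζ hζ
    rw [hR ζ hζ]
    simp [hL]
  have hRQ : ∀ ζ ∈ Icc (0 : ℝ) 1, R ζ * Q ζ = 1 := by
    intro ζ hζ
    have := bilin_eq_add_integral L hRA hAQ (fun ζ hζ => hR0 ▸ hR' ζ hζ)
      (fun ζ hζ => hQ0 ▸ hQ' ζ hζ) ζ hζ
    simp only [hL, ContinuousLinearMap.mul_apply', hR0, hQ0] at this
    rw [this]
    simp [mul_assoc]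
  refine ⟨Q, R, hQc, hRc, hQ0, hR0, hQ', hR', hRQ, fun ζ hζ => ?_, hAi⟩
  have h1 : (R ζ : E →ₗ[ℂ] E) * (Q ζ : E →ₗ[ℂ] E) = 1 := by
    ext x
    exact DFunLike.congr_fun (hRQ ζ hζ) x
  ext x
  exact DFunLike.congr_fun (mul_eq_one_comm.1 h1) x

section

/-! ### Solutions transported along characteristics -/

theorem ae_restrict_Ioc_of_ae_spaceMeasure {p : ℝ → Prop} (h : ∀ᵐ ζ ∂spaceMeasure, p ζ) {ζ : ℝ}
    (hζ : ζ ≤ 1) : ∀ᵐ s ∂volume.restrict (Ioc 0 ζ), p s := by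
  rw [← restrict_Ioo_eq_restrict_Ioc]
  exact ae_restrict_of_ae_restrict_of_subset (Ioo_subset_Ioo_right hζ) h

theorem integral_congr_spaceMeasure {F : Type*} [NormedAddCommGroup F] [NormedSpace ℝ F]
    {f g : ℝ → F} (h : f =ᵐ[spaceMeasure] g) {ζ : ℝ} (hζ : ζ ∈ Icc (0 : ℝ) 1) :
    ∫ s in (0 : ℝ)..ζ, f s = ∫ s in (0 : ℝ)..ζ, g s := by
  rw [intervalIntegral.integral_of_le hζ.1, intervalIntegral.integral_of_le hζ.1]
  exact integral_congr_ae (ae_restrict_Ioc_of_ae_spaceMeasure h hζ.2)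

/-- If increments of `f` are dominated pointwise by those of `g`, continuity of `g` in `L²` passes
to `f`. -/
theorem continuousAt_Lp_of_norm_sub_le {Ω E F : Type*} [MeasurableSpace Ω] [NormedAddCommGroup E]
    [NormedAddCommGroup F] {μ ν : Measure Ω} {k : ENNReal} (hk : k ≠ ⊤) (hle : μ ≤ k • ν)
    {D : NNReal} {f : ℝ → Lp E 2 μ} {g : ℝ → Lp F 2 ν} {t : ℝ} (hg : ContinuousAt g t)
    (h : ∀ᶠ s in 𝓝 t, ∀ᵐ ω ∂μ, ‖f s ω - f t ω‖ ≤ D * ‖g s ω - g t ω‖) : ContinuousAt f t := by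
  rw [ContinuousAt, Lp.tendsto_Lp_iff_tendsto_eLpNorm'] at hg ⊢
  have hbound : ∀ᶠ s in 𝓝 t, eLpNorm (⇑(f s) - ⇑(f t)) 2 μ ≤
      (D * k ^ ((1 / (2 : ENNReal)).toReal)) * eLpNorm (⇑(g s) - ⇑(g t)) 2 ν := by
    filter_upwards [h] with s hs
    refine (eLpNorm_le_nnreal_smul_eLpNorm_of_ae_le_mul (g := ⇑(g s) - ⇑(g t)) hs 2).trans ?_
    rw [ENNReal.smul_def, smul_eq_mul, mul_assoc]
    exact mul_le_mul_right (eLpNorm_le_of_measure_le_smul (f := ⇑(g s) - ⇑(g t)) (p := 2) hle) _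
  refine tendsto_of_tendsto_of_tendsto_of_le_of_le' tendsto_const_nhds ?_
    (Eventually.of_forall fun _ => zero_le) hbound
  have := ENNReal.Tendsto.const_mul hg (a := (D * k ^ ((1 / (2 : ENNReal)).toReal) : ENNReal))
    (Or.inr (ENNReal.mul_ne_top ENNReal.coe_ne_top
      (ENNReal.rpow_ne_top_of_nonneg (by positivity) hk)))
  simpa using this

variable {n : ℕ}

/-- The state at time `t` of the solution with profile `φ`. -/
def profileState (r : ℝ → ℝ)
    (Q : ℝ → EuclideanSpace ℂ (Fin n) →L[ℂ] EuclideanSpace ℂ (Fin n))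
    (φ : ℝ → EuclideanSpace ℂ (Fin n)) (t ζ : ℝ) : EuclideanSpace ℂ (Fin n) :=
  r ζ • Q ζ (φ (t - travelTime r ζ))

/-- The flux at time `t` of the time integral of the solution with profile `φ`. -/
def profileFlux (r : ℝ → ℝ)
    (Q : ℝ → EuclideanSpace ℂ (Fin n) →L[ℂ] EuclideanSpace ℂ (Fin n))
    (φ : ℝ → EuclideanSpace ℂ (Fin n)) (t ζ : ℝ) : EuclideanSpace ℂ (Fin n) :=
  Q ζ (∫ x in (-travelTime r ζ)..(t - travelTime r ζ), φ x)

variable {r : ℝ → ℝ} {a b : ℝ} {lam : ℝ → ℝ} {M : ℝ → Matrix (Fin n) (Fin n) ℂ}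
  {Q R : ℝ → EuclideanSpace ℂ (Fin n) →L[ℂ] EuclideanSpace ℂ (Fin n)}
  {φ : ℝ → EuclideanSpace ℂ (Fin n)}

theorem stronglyMeasurable_profileState (hr : IsSlowness r a b) (hQ : Continuous Q)
    (hφ : StronglyMeasurable φ) :
    StronglyMeasurable (Function.uncurry (profileState r Q φ)) := by
  refine (hr.measurable.comp measurable_snd).stronglyMeasurable.smul ?_
  refine (isBoundedBilinearMap_apply (𝕜 := ℂ)).continuous.comp_stronglyMeasurable
    ((hQ.comp continuous_snd).stronglyMeasurable.prodMk
      (hφ.comp_measurable (measurable_fst.sub (hr.continuous.measurable.comp measurable_snd))))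

/-- On the interval `(0, 1)`, the state is controlled by the translated profile, of which only the
part before time `c` matters. -/
theorem exists_norm_profileState_sub_le (hr : IsSlowness r a b) (hQ : Continuous Q) :
    ∃ D : NNReal, ∀ (φ : ℝ → EuclideanSpace ℂ (Fin n)) (s t c : ℝ), s < c → t < c →
      ∀ ζ ∈ Ioo (0 : ℝ) 1, ‖profileState r Q φ s ζ - profileState r Q φ t ζ‖ ≤
        D * ‖(Iio c).indicator φ (s - travelTime r ζ) -
          (Iio c).indicator φ (t - travelTime r ζ)‖ := by
  obtain ⟨C, hC⟩ := isCompact_Icc.exists_bound_of_continuousOn (hQ.continuousOn (s := Icc 0 1))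
  have hC0 : 0 ≤ C := (norm_nonneg _).trans (hC 0 (by simp))
  have hb0 : 0 ≤ b := (hr.pos_apply 0).le.trans (hr.ge 0)
  refine ⟨Real.toNNReal (b * C), fun φ s t c hs ht ζ hζ => ?_⟩
  have hτ := hr.travelTime_mem_Ioo hζ
  have h1 : s - travelTime r ζ ∈ Iio c := by simp only [mem_Iio]; linarith [hτ.1]
  have h2 : t - travelTime r ζ ∈ Iio c := by simp only [mem_Iio]; linarith [hτ.1]
  rw [indicator_of_mem h1, indicator_of_mem h2, profileState, profileState, ← smul_sub, ← map_sub,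
    norm_smul, Real.norm_of_nonneg (hr.pos_apply ζ).le, Real.coe_toNNReal _ (by positivity), mul_assoc]
  exact mul_le_mul (hr.ge ζ) (((Q ζ).le_opNorm _).trans (by
    gcongr; exact hC ζ (Ioo_subset_Icc_self hζ))) (norm_nonneg _) hb0

theorem memLp_profileState (hr : IsSlowness r a b) (hQ : Continuous Q) (hφ : IsProfile φ) (t : ℝ) :
    MemLp (profileState r Q φ t) 2 spaceMeasure := by
  obtain ⟨C, hC⟩ := isCompact_Icc.exists_bound_of_continuousOn (hQ.continuousOn (s := Icc 0 1))
  have hC0 : 0 ≤ C := (norm_nonneg _).trans (hC 0 (by simp))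
  have hb0 : 0 ≤ b := (hr.pos_apply 0).le.trans (hr.ge 0)
  have h := (hr.memLp_comp (hφ.memLp (t + 1)) t).restrict (Ioo 0 1)
  refine h.of_le_mul (c := b * C) ?_ ?_
  · exact ((stronglyMeasurable_profileState hr hQ hφ.stronglyMeasurable).comp_measurable
      (measurable_const.prodMk measurable_id)).aestronglyMeasurable
  · filter_upwards [ae_restrict_mem measurableSet_Ioo] with ζ hζ
    have hτ := hr.travelTime_mem_Ioo hζ
    have h1 : t - travelTime r ζ ∈ Iio (t + 1) := by simp only [mem_Iio]; linarith [hτ.1]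
    rw [indicator_of_mem h1, profileState, norm_smul, Real.norm_of_nonneg (hr.pos_apply ζ).le,
      mul_assoc]
    exact mul_le_mul (hr.ge ζ) (((Q ζ).le_opNorm _).trans (by
      gcongr; exact hC ζ (Ioo_subset_Icc_self hζ))) (norm_nonneg _) hb0

/-- Translation is continuous in `L²`, also when expressed in the travel time coordinate. -/
theorem exists_continuous_translation {F : Type*} [NormedAddCommGroup F] (hr : IsSlowness r a b)
    {ψ : ℝ → F} (hψ : MemLp ψ 2 volume) :
    ∃ Ψ : ℝ → Lp F 2 (slownessMeasure r), Continuous Ψ ∧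
      ∀ t, ∀ᵐ ζ ∂slownessMeasure r, Ψ t ζ = ψ (t - travelTime r ζ) := by
  have hlf := hr.isLocallyFiniteMeasure
  have hrc := hr.continuous
  let τ : ℝ → C(ℝ, ℝ) := fun s => ⟨fun ζ => s - travelTime r ζ, by fun_prop⟩
  have hτ : Continuous τ := ContinuousMap.continuous_of_continuous_uncurry _ (by
    simp only [τ, ContinuousMap.coe_mk, Function.uncurry_def]
    fun_prop)
  exact ⟨fun s => Lp.compMeasurePreserving (τ s) (hr.measurePreserving_sub s) (hψ.toLp ψ),
    continuous_const.compMeasurePreservingLp hτ (fun s => hr.measurePreserving_sub s)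
      (by norm_num), fun s => (Lp.coeFn_compMeasurePreserving _ (hr.measurePreserving_sub s)).trans
      ((hr.measurePreserving_sub s).quasiMeasurePreserving.ae_eq_comp hψ.coeFn_toLp)⟩

theorem continuous_of_ae_eq_profileState (hr : IsSlowness r a b) (hQ : Continuous Q)
    (hφ : IsProfile φ) {z : ℝ → State n}
    (hz : ∀ t, ∀ᵐ ζ ∂spaceMeasure, z t ζ = profileState r Q φ t ζ) : Continuous z := by
  obtain ⟨D, hD⟩ := exists_norm_profileState_sub_le hr hQ
  rw [continuous_iff_continuousAt]
  intro t
  obtain ⟨Ψ, hΨ, hΨae⟩ := exists_continuous_translation hr (hφ.memLp (t + 1))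
  have hle : (spaceMeasure : Measure ℝ) ≤ (ENNReal.ofReal a)⁻¹ • slownessMeasure r :=
    Measure.restrict_le_self.trans hr.volume_le_smul
  have hac : (spaceMeasure : Measure ℝ) ≪ slownessMeasure r :=
    (Measure.absolutelyContinuous_of_le hle).trans Measure.smul_absolutelyContinuous
  refine continuousAt_Lp_of_norm_sub_le (ENNReal.inv_ne_top.2 (by simpa using hr.pos)) hle
    (D := D) (hΨ.continuousAt (x := t)) ?_
  filter_upwards [Iio_mem_nhds (show t < t + 1 by linarith)] with s hs
  filter_upwards [hz s, hz t, hac.ae_le (hΨae s), hac.ae_le (hΨae t),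
    ae_restrict_mem measurableSet_Ioo] with ζ e1 e2 e3 e4 hζ
  rw [e1, e2, e3, e4]
  exact hD φ s t (t + 1) hs (by linarith) ζ hζ

theorem continuous_profileFlux (hr : IsSlowness r a b) (hQ : Continuous Q) (hφ : IsProfile φ)
    (t : ℝ) : Continuous (profileFlux r Q φ t) := by
  have hp : Continuous fun x => ∫ s in (0 : ℝ)..x, φ s :=
    intervalIntegral.continuous_primitive (fun x y => hφ.intervalIntegrable x y) 0
  have e : profileFlux r Q φ t = fun ζ => Q ζ ((∫ s in (0 : ℝ)..(t - travelTime r ζ), φ s) -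
      ∫ s in (0 : ℝ)..(-travelTime r ζ), φ s) := by
    ext1 ζ
    rw [profileFlux, intervalIntegral.integral_interval_sub_left (hφ.intervalIntegrable _ _)
      (hφ.intervalIntegrable _ _)]
  rw [e]
  have hτ := hr.continuous
  exact hQ.clm_apply ((hp.comp (by fun_prop)).sub (hp.comp (by fun_prop)))

/-- The weak derivative of the flux is `r M w + z(0) - z(t)`. -/
theorem profileFlux_eq_integral (hr : IsSlowness r a b) (hQ : IsFundamental (odeCoeff r M) Q R)
    (hφ : IsProfile φ) (t : ℝ) : ∀ ζ ∈ Icc (0 : ℝ) 1, profileFlux r Q φ t ζ =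
      profileFlux r Q φ t 0 + ∫ s in (0 : ℝ)..ζ, (odeCoeff r M s (profileFlux r Q φ t s) +
        (profileState r Q φ 0 s - profileState r Q φ t s)) := by
  have hrev : ∀ u, ∀ ζ, 0 ≤ ζ → ∫ x in (u - travelTime r ζ)..u, φ x =
      ∫ s in (0 : ℝ)..ζ, r s • φ (u - travelTime r s) := fun u ζ hζ => by
    rw [hr.integral_comp (fun x => φ (u - x)) hζ, travelTime_zero,
      intervalIntegral.integral_comp_sub_left, sub_zero]
  have hint : ∀ u, ∀ ζ, 0 ≤ ζ →
      IntervalIntegrable (fun s => r s • φ (u - travelTime r s)) volume 0 ζ := fun u ζ hζ =>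
    hr.intervalIntegrable_comp (f := fun x => φ (u - x)) hζ
      (by simpa using (hφ.intervalIntegrable (u - travelTime r 0)
        (u - travelTime r ζ)).comp_sub_left u)
  have hD : ∀ ζ ∈ Icc (0 : ℝ) 1, ∫ x in (-travelTime r ζ)..(t - travelTime r ζ), φ x =
      (∫ x in (-travelTime r 0)..(t - travelTime r 0), φ x) +
        ∫ s in (0 : ℝ)..ζ, (r s • φ (0 - travelTime r s) - r s • φ (t - travelTime r s)) := by
    intro ζ hζ
    rw [intervalIntegral.integral_sub (hint 0 ζ hζ.1) (hint t ζ hζ.1), ← hrev 0 ζ hζ.1,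
      ← hrev t ζ hζ.1, travelTime_zero, neg_zero, sub_zero, zero_sub,
      ← intervalIntegral.integral_add_adjacent_intervals (hφ.intervalIntegrable _ 0)
      (hφ.intervalIntegrable 0 _), ← intervalIntegral.integral_add_adjacent_intervals
      (hφ.intervalIntegrable 0 (t - travelTime r ζ)) (hφ.intervalIntegrable _ t)]
    abel
  intro ζ hζ
  have := bilin_eq_add_integral (ContinuousLinearMap.id ℂ
      (EuclideanSpace ℂ (Fin n) →L[ℂ] EuclideanSpace ℂ (Fin n)))
    (hQ.intervalIntegrable.bilin_continuousOn (ContinuousLinearMap.mul ℂ _)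
      hQ.continuous_Q.continuousOn)
    ((hint 0 1 zero_le_one).sub (hint t 1 zero_le_one))
    (f := Q) (fun ζ hζ => by rw [hQ.Q_zero]; exact hQ.Q_eq ζ hζ) hD ζ hζ
  simp only [ContinuousLinearMap.id_apply] at this
  rw [profileFlux, this]
  congr 1
  refine intervalIntegral.integral_congr fun s _ => ?_
  have h1 : ∀ x, Q s (r s • x) = r s • Q s x := fun x =>
    ContinuousLinearMap.map_smul_of_tower (Q s) (r s) x
  simp only [profileFlux, profileState, zero_sub, map_sub, h1]
  rfl

/-- Every profile `φ` yields a solution of the differential equation, with flux traces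
`∫₀ᵗ φ` at `0` and `Q(1) ∫_{-T}^{t-T} φ` at `1`. -/
theorem exists_solution_of_profile (hr : IsSlowness r a b)
    (hlr : ∀ᵐ ζ ∂spaceMeasure, r ζ * lam ζ = 1)
    (hM : ∀ i j, MemLp (fun ζ => M ζ i j) ⊤ spaceMeasure)
    (hQ : IsFundamental (odeCoeff r M) Q R) (hφ : IsProfile φ) :
    ∃ z : ℝ → State n, Continuous z ∧ (∀ t, z t =ᵐ[spaceMeasure] profileState r Q φ t) ∧
      ∀ t, 0 ≤ t → ∃ g : State n,
        IsFlux lam (∫ s in (0 : ℝ)..t, z s) (profileFlux r Q φ t) g ∧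
        ∀ᵐ ζ ∂spaceMeasure, (z t : ℝ → EuclideanSpace ℂ (Fin n)) ζ =
          z 0 ζ - g ζ + (M ζ).toEuclideanLin ((∫ s in (0 : ℝ)..t, z s : State n) ζ) := by
  obtain ⟨z, hz⟩ : ∃ z : ℝ → State n, ∀ t, ∀ᵐ ζ ∂spaceMeasure, z t ζ = profileState r Q φ t ζ :=
    ⟨fun t => (memLp_profileState hr hQ.continuous_Q hφ t).toLp _, fun t => MemLp.coeFn_toLp _⟩
  have hzc := continuous_of_ae_eq_profileState hr hQ.continuous_Q hφ hz
  refine ⟨z, hzc, hz, fun t ht => ?_⟩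
  have hZ : (∫ s in (0 : ℝ)..t, z s : State n) =ᵐ[spaceMeasure]
      fun ζ => r ζ • profileFlux r Q φ t ζ := by
    refine (coeFn_integral_Lp ht (stronglyMeasurable_profileState hr hQ.continuous_Q
      hφ.stronglyMeasurable) (fun s _ => hz s) hzc.continuousOn).trans
      (Eventually.of_forall fun ζ => ?_)
    simp only [profileState]
    rw [intervalIntegral.integral_smul, (Q ζ).intervalIntegral_comp_comm,
      intervalIntegral.integral_comp_sub_right, zero_sub, profileFlux]
    simpa using (hφ.intervalIntegrable (0 - travelTime r ζ) (t - travelTime r ζ)).comp_sub_right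
      (travelTime r ζ)
  have hA := memLp_odeCoeff hr hM
  obtain ⟨C, hC⟩ := ae_norm_le_of_memLp_top hA
  obtain ⟨C', hC'⟩ := isCompact_Icc.exists_bound_of_continuousOn
    ((continuous_profileFlux hr hQ.continuous_Q hφ t).continuousOn (s := Icc 0 1))
  have hAw : MemLp (fun ζ => odeCoeff r M ζ (profileFlux r Q φ t ζ)) 2 spaceMeasure := by
    refine MemLp.of_bound ((ContinuousLinearMap.id ℂ
      (EuclideanSpace ℂ (Fin n) →L[ℂ] EuclideanSpace ℂ (Fin n))).aestronglyMeasurable_comp₂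
        hA.aestronglyMeasurable
        (continuous_profileFlux hr hQ.continuous_Q hφ t).aestronglyMeasurable) (C * C') ?_
    filter_upwards [hC, ae_restrict_mem measurableSet_Ioo] with ζ h1 h2
    exact ((odeCoeff r M ζ).le_opNorm _).trans (mul_le_mul h1 (hC' ζ (Ioo_subset_Icc_self h2))
      (norm_nonneg _) ((norm_nonneg _).trans h1))
  have hg := hAw.add ((memLp_profileState hr hQ.continuous_Q hφ 0).sub
    (memLp_profileState hr hQ.continuous_Q hφ t))
  refine ⟨hg.toLp _, ⟨?_, fun ζ hζ => ?_⟩, ?_⟩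
  · filter_upwards [hZ, hlr] with ζ h1 h2
    rw [h1, Complex.coe_smul, smul_smul, mul_comm, h2, one_smul]
  · rw [profileFlux_eq_integral hr hQ hφ t ζ hζ, integral_congr_spaceMeasure hg.coeFn_toLp hζ]
    rfl
  · filter_upwards [hz t, hz 0, hg.coeFn_toLp, hZ] with ζ h1 h2 h3 h4
    rw [h1, h2, h3, h4]
    simp only [Pi.add_apply, Pi.sub_apply, odeCoeff_apply]
    have : (M ζ).toEuclideanLin (r ζ • profileFlux r Q φ t ζ) =
        r ζ • (M ζ).toEuclideanLin (profileFlux r Q φ t ζ) :=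
      LinearMap.map_smul_of_tower _ _ _
    rw [this]
    abel

end

section

/-! ### Every solution with zero initial state is transported -/

variable {n : ℕ} {r : ℝ → ℝ} {a b : ℝ} {lam : ℝ → ℝ} {M : ℝ → Matrix (Fin n) (Fin n) ℂ}
  {Q R : ℝ → EuclideanSpace ℂ (Fin n) →L[ℂ] EuclideanSpace ℂ (Fin n)}

theorem intervalIntegrable_state (f : State n) : IntervalIntegrable f volume 0 1 :=
  intervalIntegrable_zero_one_of_integrable ((Lp.memLp f).integrable (by norm_num))

theorem intervalIntegral_eq_indicator {F : Type*} [NormedAddCommGroup F] [NormedSpace ℝ F]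
    (f : ℝ → F) {ζ : ℝ} (hζ : ζ ∈ Icc (0 : ℝ) 1) :
    ∫ s in (0 : ℝ)..ζ, f s = ∫ s, (Iic ζ).indicator f s ∂spaceMeasure := by
  rw [intervalIntegral.integral_of_le hζ.1, integral_indicator measurableSet_Iic, spaceMeasure,
    restrict_Ioo_eq_restrict_Ioc, Measure.restrict_restrict measurableSet_Iic, inter_comm,
    Ioc_inter_Iic, min_eq_right hζ.2]

/-- The functionals `f ↦ ∫₀^ζ R f` on the state space, uniformly bounded in `ζ`. -/
theorem exists_primitive_clm (hR : Continuous R) :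
    ∃ (C : NNReal) (P : ℝ → State n →L[ℂ] EuclideanSpace ℂ (Fin n)), ∀ ζ ∈ Icc (0 : ℝ) 1,
      (∀ f : State n, P ζ f = ∫ s in (0 : ℝ)..ζ, R s (f s)) ∧ ∀ f, ‖P ζ f‖ ≤ C * ‖f‖ := by
  obtain ⟨C, hC⟩ := isCompact_Icc.exists_bound_of_continuousOn (hR.continuousOn (s := Icc 0 1))
  have hC0 : 0 ≤ C := (norm_nonneg _).trans (hC 0 (by simp))
  have h : ∀ ζ : ℝ, ∃ P : State n →L[ℂ] EuclideanSpace ℂ (Fin n),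
      (∀ f, P f = ∫ s, (Ioo 0 1 ∩ Iic ζ).indicator R s (f s) ∂spaceMeasure) ∧
        ∀ f, ‖P f‖ ≤ C * √((spaceMeasure : Measure ℝ).real univ) * ‖f‖ := fun ζ =>
    exists_integral_clm (μ := spaceMeasure)
      (hR.aestronglyMeasurable.indicator (measurableSet_Ioo.inter measurableSet_Iic)) fun s => by
        by_cases hs : s ∈ Ioo (0 : ℝ) 1 ∩ Iic ζ
        · rw [indicator_of_mem hs]; exact hC s (Ioo_subset_Icc_self hs.1)
        · rw [indicator_of_notMem hs, norm_zero]; exact hC0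
  choose P hP hPb using h
  refine ⟨⟨C * √((spaceMeasure : Measure ℝ).real univ), by positivity⟩, P,
    fun ζ hζ => ⟨fun f => ?_, hPb ζ⟩⟩
  rw [hP, intervalIntegral_eq_indicator _ hζ]
  refine integral_congr_ae ?_
  filter_upwards [ae_restrict_mem measurableSet_Ioo] with s hs
  by_cases h : s ≤ ζ <;> simp [indicator, h, hs.1, hs.2]

/-- A solution with zero initial state: `z` is continuous in time and its time integral has
the flux `w`, with weak derivative `M Z - z`. No boundary condition is prescribed. -/
structure IsNullSolution (lam : ℝ → ℝ) (M : ℝ → Matrix (Fin n) (Fin n) ℂ) (z : ℝ → State n)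
    (w : ℝ → ℝ → EuclideanSpace ℂ (Fin n)) : Prop where
  continuousOn : ContinuousOn z (Ici 0)
  flux : ∀ t, 0 ≤ t → ∃ g : State n, IsFlux lam (∫ s in (0 : ℝ)..t, z s) (w t) g ∧
    ∀ᵐ ζ ∂spaceMeasure, (z t : ℝ → EuclideanSpace ℂ (Fin n)) ζ =
      -g ζ + (M ζ).toEuclideanLin ((∫ s in (0 : ℝ)..t, z s : State n) ζ)

namespace IsNullSolution

variable {z : ℝ → State n} {w : ℝ → ℝ → EuclideanSpace ℂ (Fin n)}

theorem smul_flux_ae (h : IsNullSolution lam M z w)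
    (hlr : ∀ᵐ ζ ∂spaceMeasure, r ζ * lam ζ = 1) {t : ℝ} (ht : 0 ≤ t) :
    ∀ᵐ ζ ∂spaceMeasure, r ζ • w t ζ = (∫ s in (0 : ℝ)..t, z s : State n) ζ := by
  obtain ⟨g, hg, -⟩ := h.flux t ht
  filter_upwards [hg.ae_eq, hlr] with ζ h1 h2
  rw [h1, Complex.coe_smul, smul_smul, h2, one_smul]

/-- In the frame given by `R = Q⁻¹`, the zero order term disappears. -/
theorem R_flux_eq (h : IsNullSolution lam M z w) (hlr : ∀ᵐ ζ ∂spaceMeasure, r ζ * lam ζ = 1)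
    (hQ : IsFundamental (odeCoeff r M) Q R) {t : ℝ} (ht : 0 ≤ t) :
    ∀ ζ ∈ Icc (0 : ℝ) 1, R ζ (w t ζ) = w t 0 - ∫ s in (0 : ℝ)..ζ, R s (z t s) := by
  obtain ⟨g, hg, hz⟩ := h.flux t ht
  intro ζ hζ
  have hRA := (hQ.intervalIntegrable.bilin_continuousOn (ContinuousLinearMap.mul ℂ
      (EuclideanSpace ℂ (Fin n) →L[ℂ] EuclideanSpace ℂ (Fin n))).flip
      hQ.continuous_R.continuousOn).neg
  have := bilin_eq_add_integral (ContinuousLinearMap.id ℂ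
      (EuclideanSpace ℂ (Fin n) →L[ℂ] EuclideanSpace ℂ (Fin n)))
    hRA (intervalIntegrable_state g) (f := R)
    (fun ζ hζ => by rw [hQ.R_zero]; exact hQ.R_eq ζ hζ) hg.eq_integral ζ hζ
  simp only [ContinuousLinearMap.id_apply, hQ.R_zero] at this
  rw [this, sub_eq_add_neg, ← intervalIntegral.integral_neg]
  congr 1
  refine integral_congr_spaceMeasure ?_ hζ
  filter_upwards [hz, h.smul_flux_ae hlr ht] with s h1 h2
  have h3 : odeCoeff r M s (w t s) = z t s + g s := by
    rw [odeCoeff_apply, h1, ← h2, neg_add_cancel_comm]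
    exact (LinearMap.map_smul_of_tower (M s).toEuclideanLin (r s) (w t s)).symm
  change -(R s (odeCoeff r M s (w t s))) + R s (g s) = -(R s (z t s))
  rw [h3, map_add]
  abel

/-- The trace of the flux at `0` is continuous in time: integrating the derivative of
`(T - τ(ζ)) R(ζ) w(t, ζ)` over `[0, 1]` expresses `T w(t, 0)` by continuous functionals of `z(t)`
and of its time integral. -/
theorem continuousOn_flux_zero (h : IsNullSolution lam M z w) (hr : IsSlowness r a b)
    (hlr : ∀ᵐ ζ ∂spaceMeasure, r ζ * lam ζ = 1)
    (hQ : IsFundamental (odeCoeff r M) Q R) : ContinuousOn (fun t => w t 0) (Ici 0) := by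
  set T := travelTime r 1 with hT
  have hT0 : 0 < T := hr.travelTime_one_pos
  obtain ⟨C, P, hP⟩ := exists_primitive_clm hQ.continuous_R
  have hR' : Continuous fun ζ => ((T - travelTime r ζ : ℝ) : ℂ) • R ζ :=
    (Complex.continuous_ofReal.comp (continuous_const.sub hr.continuous)).smul hQ.continuous_R
  obtain ⟨C', P', hP'⟩ := exists_primitive_clm hR'
  have h1 : (1 : ℝ) ∈ Icc (0 : ℝ) 1 := by simp
  have hZ : ContinuousOn (fun t => ∫ s in (0 : ℝ)..t, z s) (Ici 0) := by
    have hc : Continuous fun t => z (max t 0) :=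
      continuousOn_univ.1 (h.continuousOn.comp (by fun_prop) fun t _ => le_max_right t 0)
    refine (intervalIntegral.continuous_primitive (μ := volume)
      (fun x y => hc.intervalIntegrable x y) 0).continuousOn.congr fun t ht => ?_
    refine intervalIntegral.integral_congr fun s hs => ?_
    rw [uIcc_of_le ht] at hs
    simp only [max_eq_left hs.1]
  have e : EqOn (fun t => w t 0)
      (fun t => T⁻¹ • (P 1 (∫ s in (0 : ℝ)..t, z s) + P' 1 (z t))) (Ici 0) := by
    intro t ht
    rw [mem_Ici] at ht
    have hRz : IntervalIntegrable (fun s => -(R s (z t s))) volume 0 1 :=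
      ((intervalIntegrable_state (z t)).bilin_continuousOn (ContinuousLinearMap.id ℂ
        (EuclideanSpace ℂ (Fin n) →L[ℂ] EuclideanSpace ℂ (Fin n))).flip
        hQ.continuous_R.continuousOn).neg
    have hW : ∀ ζ ∈ Icc (0 : ℝ) 1, R ζ (w t ζ) = R 0 (w t 0) +
        ∫ s in (0 : ℝ)..ζ, -(R s (z t s)) := fun ζ hζ => by
      rw [h.R_flux_eq hlr hQ ht ζ hζ, hQ.R_zero, intervalIntegral.integral_neg, sub_eq_add_neg]
      rfl
    have hτ : ∀ ζ ∈ Icc (0 : ℝ) 1, T - travelTime r ζ = (T - travelTime r 0) +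
        ∫ s in (0 : ℝ)..ζ, -(r s) := fun ζ _ => by
      rw [intervalIntegral.integral_neg, ← hr.travelTime_sub]
      ring
    have := bilin_eq_add_integral (ContinuousLinearMap.lsmul ℝ ℝ :
      ℝ →L[ℝ] EuclideanSpace ℂ (Fin n) →L[ℝ] EuclideanSpace ℂ (Fin n))
      (hr.intervalIntegrable 0 1).neg hRz hτ hW 1 h1
    simp only [ContinuousLinearMap.lsmul_apply, ← hT, sub_self, zero_smul, travelTime_zero,
      sub_zero, hQ.R_zero] at this
    rw [eq_comm, add_eq_zero_iff_eq_neg, ← intervalIntegral.integral_neg] at this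
    have e1 : ∫ s in (0 : ℝ)..1, -((-r s) • R s (w t s) + (T - travelTime r s) • -(R s (z t s))) =
        ∫ s in (0 : ℝ)..1, (R s ((∫ s in (0 : ℝ)..t, z s : State n) s) +
          (((T - travelTime r s : ℝ) : ℂ) • R s) (z t s)) := by
      refine integral_congr_spaceMeasure ?_ h1
      filter_upwards [h.smul_flux_ae hlr ht] with s hs
      rw [← hs, smul_apply, Complex.coe_smul, smul_neg, neg_add, neg_smul, neg_neg, neg_neg]
      congr 1
      exact (ContinuousLinearMap.map_smul_of_tower (R s) (r s) (w t s)).symm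
    have e2 : T • w t 0 = P 1 (∫ s in (0 : ℝ)..t, z s) + P' 1 (z t) := by
      rw [(hP 1 h1).1, (hP' 1 h1).1, ← intervalIntegral.integral_add, ← e1]
      · exact this
      · exact (intervalIntegrable_state _).bilin_continuousOn (ContinuousLinearMap.id ℂ
          (EuclideanSpace ℂ (Fin n) →L[ℂ] EuclideanSpace ℂ (Fin n))).flip
          hQ.continuous_R.continuousOn
      · exact (intervalIntegrable_state _).bilin_continuousOn (ContinuousLinearMap.id ℂ
          (EuclideanSpace ℂ (Fin n) →L[ℂ] EuclideanSpace ℂ (Fin n))).flip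
          hR'.continuousOn
    simp only
    rw [← e2, smul_smul, inv_mul_cancel₀ hT0.ne', one_smul]
  refine ContinuousOn.congr ?_ e
  exact (((P 1).continuous.comp_continuousOn hZ).add
    ((P' 1).continuous.comp_continuousOn h.continuousOn)).const_smul T⁻¹

/-- The flux of a solution with zero initial state, in the frame `R = Q⁻¹`, is constant along
characteristics, and vanishes at the points not yet reached from the boundary. -/
theorem transport (h : IsNullSolution lam M z w) (hr : IsSlowness r a b)
    (hlr : ∀ᵐ ζ ∂spaceMeasure, r ζ * lam ζ = 1)
    (hQ : IsFundamental (odeCoeff r M) Q R) {ζ : ℝ} (hζ : ζ ∈ Icc (0 : ℝ) 1) (t : ℝ) :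
    (0 ≤ t → R ζ (w (t + travelTime r ζ) ζ) = w t 0) ∧
      (t ∈ Icc 0 (travelTime r ζ) → R ζ (w t ζ) = 0) := by
  obtain ⟨C, P, hP⟩ := exists_primitive_clm hQ.continuous_R
  obtain ⟨e, he⟩ := hr.exists_homeomorph
  set T := travelTime r 1 with hT
  set σ : ℝ → ℝ := fun x => e.symm x with hσ
  have hτσ : ∀ x, travelTime r (σ x) = x := fun x => he ▸ e.apply_symm_apply x
  have hστ : ∀ x, σ (travelTime r x) = x := fun x => he ▸ e.symm_apply_apply x
  have hσc : Continuous σ := e.symm.continuous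
  have hσm : ∀ x ∈ Icc 0 T, σ x ∈ Icc (0 : ℝ) 1 := fun x hx => by
    constructor
    · rw [← hr.strictMono.le_iff_le, hτσ, travelTime_zero]; exact hx.1
    · rw [← hr.strictMono.le_iff_le, hτσ]; exact hx.2
  have hσ0 : σ 0 = 0 := by simpa using hστ 0
  set W : ℝ → ℝ → EuclideanSpace ℂ (Fin n) := fun t x => R (σ x) (w t (σ x)) with hW
  have hW0 : ∀ t, W t 0 = w t 0 := fun t => by simp [hW, hσ0, hQ.R_zero]
  have hWeq : ∀ t, 0 ≤ t → ∀ x ∈ Icc 0 T, W t x = w t 0 - P (σ x) (z t) := fun t ht x hx => by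
    rw [(hP _ (hσm x hx)).1]
    exact h.R_flux_eq hlr hQ ht _ (hσm x hx)
  have hc := h.continuousOn_flux_zero hr hlr hQ
  have hPc : ContinuousOn (fun q : State n × ℝ => P (σ q.2) q.1) (univ ×ˢ Icc 0 T) := by
    refine continuousOn_prod_of_continuousOn_lipschitzOnWith _ C (fun f _ => ?_) (fun x hx => ?_)
    · have hp : ContinuousOn (fun x => ∫ s in (0 : ℝ)..x, R s (f s)) (uIcc 0 1) :=
        intervalIntegral.continuousOn_primitive_interval
          ((intervalIntegrable_iff' (by simp)).1
            ((intervalIntegrable_state f).bilin_continuousOn (ContinuousLinearMap.id ℂ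
        (EuclideanSpace ℂ (Fin n) →L[ℂ] EuclideanSpace ℂ (Fin n))).flip
        hQ.continuous_R.continuousOn))
      rw [uIcc_of_le zero_le_one] at hp
      exact (hp.comp hσc.continuousOn hσm).congr fun x hx => (hP _ (hσm x hx)).1 f
    · refine LipschitzOnWith.of_dist_le_mul fun f _ g _ => ?_
      rw [dist_eq_norm, dist_eq_norm, ← map_sub]
      exact (hP _ (hσm x hx)).2 _
  have hWc : ContinuousOn (fun q : ℝ × ℝ => W q.1 q.2) (Ici 0 ×ˢ Icc 0 T) := by
    have h1 : ContinuousOn (fun q : ℝ × ℝ => w q.1 0 - P (σ q.2) (z q.1)) (Ici 0 ×ˢ Icc 0 T) :=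
      (hc.comp continuousOn_fst fun q hq => hq.1).sub
        (hPc.comp (f := fun q : ℝ × ℝ => (z q.1, q.2))
          ((h.continuousOn.comp continuousOn_fst fun q hq => hq.1).prodMk continuousOn_snd)
          fun q hq => ⟨mem_univ _, hq.2⟩)
    exact h1.congr fun q hq => hWeq q.1 hq.1 q.2 hq.2
  have hint : ∀ t, 0 ≤ t → ∀ x ∈ Icc 0 T, (∫ s in (0 : ℝ)..t, W s x) =
      (∫ s in (0 : ℝ)..t, W s 0) - ∫ y in (0 : ℝ)..x, W t y := by
    intro t ht x hx
    have hsub : uIcc 0 t ⊆ Ici 0 := by rw [uIcc_of_le ht]; exact Icc_subset_Ici_self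
    have hzi : IntervalIntegrable z volume 0 t := (h.continuousOn.mono hsub).intervalIntegrable
    have e1 : ∫ s in (0 : ℝ)..t, W s x = ∫ s in (0 : ℝ)..t, (w s 0 - P (σ x) (z s)) :=
      intervalIntegral.integral_congr fun s hs => hWeq s (hsub hs) x hx
    have e2 : ∫ y in (0 : ℝ)..x, W t y = P (σ x) (∫ s in (0 : ℝ)..t, z s) := by
      have h2 := hr.integral_comp (W t) (hσm x hx).1
      rw [travelTime_zero, hτσ] at h2
      rw [← h2, (hP _ (hσm x hx)).1]
      refine integral_congr_spaceMeasure ?_ (hσm x hx)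
      filter_upwards [h.smul_flux_ae hlr ht] with s hs
      simp only [hW, hστ]
      rw [← hs]
      exact (ContinuousLinearMap.map_smul_of_tower (R s) (r s) (w t s)).symm
    have hPi : IntervalIntegrable (fun s => P (σ x) (z s)) volume 0 t :=
      ((P (σ x)).continuous.comp_continuousOn (h.continuousOn.mono hsub)).intervalIntegrable
    rw [e1, e2, intervalIntegral.integral_sub (hc.mono hsub).intervalIntegrable hPi,
      (P (σ x)).intervalIntegral_comp_comm hzi]
    simp only [hW0]
  have := transport_eq hr.travelTime_one_pos hWc hint (t := t) (hr.travelTime_mem_Icc hζ)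
  rw [hW0] at this
  simpa only [hW, hστ] using this

end IsNullSolution

end

section

/-! ### Mild solutions -/

variable {n p m : ℕ} {r : ℝ → ℝ} {a b : ℝ} {lam : ℝ → ℝ} {M : ℝ → Matrix (Fin n) (Fin n) ℂ}
  {Q R : ℝ → EuclideanSpace ℂ (Fin n) →L[ℂ] EuclideanSpace ℂ (Fin n)}

theorem IsFlux.sub {f f' : State n} {w w' : ℝ → EuclideanSpace ℂ (Fin n)} {g g' : State n}
    (h : IsFlux lam f w g) (h' : IsFlux lam f' w' g') :
    IsFlux lam (f - f') (fun ζ => w ζ - w' ζ) (g - g') where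
  ae_eq := by
    filter_upwards [h.ae_eq, h'.ae_eq, Lp.coeFn_sub f f'] with ζ h1 h2 h3
    rw [h1, h2, h3, Pi.sub_apply, smul_sub]
  eq_integral ζ hζ := by
    have hi : ∀ f : State n, IntervalIntegrable f volume 0 ζ := fun f =>
      (intervalIntegrable_state f).mono_set (by
        rw [uIcc_of_le hζ.1, uIcc_of_le zero_le_one]; exact Icc_subset_Icc_right hζ.2)
    have e : ∫ s in (0 : ℝ)..ζ, (g - g' : State n) s = ∫ s in (0 : ℝ)..ζ, (g s - g' s) :=
      integral_congr_spaceMeasure (Lp.coeFn_sub g g') hζ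
    rw [e, intervalIntegral.integral_sub (hi g) (hi g'), h.eq_integral ζ hζ,
      h'.eq_integral ζ hζ]
    abel

/-- A solution of the differential equation with initial state `z₀`, whose time integral has the
flux `w`. No boundary condition is prescribed. -/
structure IsFreeSolution (lam : ℝ → ℝ) (M : ℝ → Matrix (Fin n) (Fin n) ℂ) (z₀ : State n)
    (z : ℝ → State n) (w : ℝ → ℝ → EuclideanSpace ℂ (Fin n)) : Prop where
  continuousOn : ContinuousOn z (Ici 0)
  flux : ∀ t, 0 ≤ t → ∃ g : State n, IsFlux lam (∫ s in (0 : ℝ)..t, z s) (w t) g ∧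
    ∀ᵐ ζ ∂spaceMeasure, (z t : ℝ → EuclideanSpace ℂ (Fin n)) ζ =
      z₀ ζ - g ζ + (M ζ).toEuclideanLin ((∫ s in (0 : ℝ)..t, z s : State n) ζ)

theorem IsFreeSolution.sub {z₀ : State n} {z z' : ℝ → State n}
    {w w' : ℝ → ℝ → EuclideanSpace ℂ (Fin n)} (h : IsFreeSolution lam M z₀ z w)
    (h' : IsFreeSolution lam M z₀ z' w') :
    IsNullSolution lam M (fun t => z t - z' t) (fun t ζ => w t ζ - w' t ζ) where
  continuousOn := h.continuousOn.sub h'.continuousOn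
  flux t ht := by
    have hsub : uIcc 0 t ⊆ Ici 0 := by rw [uIcc_of_le ht]; exact Icc_subset_Ici_self
    obtain ⟨g, hg, hz⟩ := h.flux t ht
    obtain ⟨g', hg', hz'⟩ := h'.flux t ht
    have e : (∫ s in (0 : ℝ)..t, (z s - z' s)) =
        (∫ s in (0 : ℝ)..t, z s) - ∫ s in (0 : ℝ)..t, z' s :=
      intervalIntegral.integral_sub (h.continuousOn.mono hsub).intervalIntegrable
        (h'.continuousOn.mono hsub).intervalIntegrable
    refine ⟨g - g', ?_, ?_⟩
    · rw [e]
      exact hg.sub hg'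
    · rw [e]
      filter_upwards [hz, hz', Lp.coeFn_sub (z t) (z' t), Lp.coeFn_sub g g',
        Lp.coeFn_sub (∫ s in (0 : ℝ)..t, z s) (∫ s in (0 : ℝ)..t, z' s)] with ζ h1 h2 h3 h4 h5
      rw [h3, h4, h5, Pi.sub_apply, Pi.sub_apply, Pi.sub_apply, h1, h2, map_sub]
      abel

theorem IsMildSolution.exists_flux {K L : Matrix (Fin n) (Fin n) ℂ} {z₀ : State n}
    {u : ℝ → EuclideanSpace ℂ (Fin p)} {z : ℝ → State n} (h : IsMildSolution lam M K L z₀ u z) :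
    ∃ w, IsFreeSolution lam M z₀ z w ∧ ∀ t, 0 ≤ t →
      (inputMatrix n p).toEuclideanLin (∫ s in (0 : ℝ)..t, u s) =
        -K.toEuclideanLin (w t 0) - L.toEuclideanLin (w t 1) := by
  choose! w g h1 h2 h3 using h.integrated
  exact ⟨w, ⟨h.continuousOn, fun t ht => ⟨g t, h1 t ht, h2 t ht⟩⟩, h3⟩

theorem IsFreeSolution.isMildSolution {K L : Matrix (Fin n) (Fin n) ℂ} {z₀ : State n}
    {u : ℝ → EuclideanSpace ℂ (Fin p)} {z : ℝ → State n}
    {w : ℝ → ℝ → EuclideanSpace ℂ (Fin n)} (h : IsFreeSolution lam M z₀ z w)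
    (hb : ∀ t, 0 ≤ t → (inputMatrix n p).toEuclideanLin (∫ s in (0 : ℝ)..t, u s) =
      -K.toEuclideanLin (w t 0) - L.toEuclideanLin (w t 1)) :
    IsMildSolution lam M K L z₀ u z where
  continuousOn := h.continuousOn
  integrated t ht := by
    obtain ⟨g, hg, hz⟩ := h.flux t ht
    exact ⟨w t, g, hg, hz, hb t ht⟩

theorem isMildSolution_zero (K L : Matrix (Fin n) (Fin n) ℂ) :
    IsMildSolution lam M K L (0 : State n) (fun _ => (0 : EuclideanSpace ℂ (Fin p)))
      (fun _ => 0) where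
  continuousOn := continuousOn_const
  integrated t _ := by
    have h0 := Lp.coeFn_zero (E := EuclideanSpace ℂ (Fin n)) (p := 2) (μ := spaceMeasure)
    refine ⟨fun _ => 0, 0, ⟨?_, fun ζ hζ => ?_⟩, ?_, by simp⟩
    · filter_upwards [h0] with ζ h1
      rw [intervalIntegral.integral_zero, h1, Pi.zero_apply, smul_zero]
    · rw [integral_congr_spaceMeasure h0 hζ]
      simp
    · filter_upwards [h0] with ζ h1
      rw [intervalIntegral.integral_zero, h1, Pi.zero_apply, map_zero, add_zero, sub_zero]

/-- Square integrable initial data as a profile on `(-T, 0)`. -/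
theorem exists_initial_profile (hr : IsSlowness r a b)
    (hQ : IsFundamental (odeCoeff r M) Q R) (z₀ : State n) :
    ∃ f : ℝ → EuclideanSpace ℂ (Fin n), IsProfile f ∧ (∀ t, t ∉ Ioo (-travelTime r 1) 0 → f t = 0) ∧
      ∀ ζ ∈ Ioo (0 : ℝ) 1, f (-travelTime r ζ) = (r ζ)⁻¹ • R ζ (z₀ ζ) := by
  obtain ⟨e, he⟩ := hr.exists_homeomorph
  obtain ⟨C, hC⟩ := isCompact_Icc.exists_bound_of_continuousOn
    (hQ.continuous_R.continuousOn (s := Icc 0 1))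
  have hC0 : 0 ≤ C := (norm_nonneg _).trans (hC 0 (by simp))
  set G : ℝ → EuclideanSpace ℂ (Fin n) :=
    (Ioo 0 1).indicator fun ζ => (r ζ)⁻¹ • R ζ (z₀ ζ) with hG
  have hGm' : StronglyMeasurable fun ζ => (r ζ)⁻¹ • R ζ (z₀ ζ) :=
    hr.measurable.inv.stronglyMeasurable.smul
      ((isBoundedBilinearMap_apply (𝕜 := ℂ)).continuous.comp_stronglyMeasurable
        (hQ.continuous_R.stronglyMeasurable.prodMk (Lp.stronglyMeasurable z₀)))
  have hGm : StronglyMeasurable G := hGm'.indicator measurableSet_Ioo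
  have hGL : MemLp G 2 volume := by
    rw [hG, memLp_indicator_iff_restrict measurableSet_Ioo]
    refine (Lp.memLp z₀).of_le_mul (c := a⁻¹ * C) hGm'.aestronglyMeasurable ?_
    filter_upwards [ae_restrict_mem measurableSet_Ioo] with ζ hζ
    rw [norm_smul, norm_inv, Real.norm_of_nonneg (hr.pos_apply ζ).le, mul_assoc]
    exact mul_le_mul (inv_anti₀ hr.pos (hr.le ζ)) (((R ζ).le_opNorm _).trans (by
      gcongr; exact hC ζ (Ioo_subset_Icc_self hζ))) (norm_nonneg _) (inv_nonneg.2 hr.pos.le)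
  have hGν : MemLp G 2 (slownessMeasure r) :=
    hGL.of_measure_le_smul ENNReal.ofReal_ne_top hr.slownessMeasure_le_smul
  -- `t ↦ τ⁻¹(-t)` maps Lebesgue measure to the measure with density `r`
  have hσ : MeasurePreserving (fun t => e.symm (-t)) volume (slownessMeasure r) :=
    (MeasurePreserving.symm e.toMeasurableEquiv
      (he ▸ hr.measurePreserving : MeasurePreserving e (slownessMeasure r) volume)).comp
      (Measure.measurePreserving_neg volume)
  refine ⟨fun t => G (e.symm (-t)), .of_memLp (hGm.comp_measurable hσ.measurable)
    (hGν.comp_measurePreserving hσ), fun t ht => ?_, fun ζ hζ => ?_⟩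
  · refine indicator_of_notMem (fun h => ht ?_) _
    have h1 := hr.travelTime_mem_Ioo h
    rw [← he, e.apply_symm_apply] at h1
    rw [he] at h1
    exact ⟨by linarith [h1.2], by linarith [h1.1]⟩
  · have : e.symm (- -travelTime r ζ) = ζ := by rw [neg_neg, ← he, e.symm_apply_apply]
    simp only [this, hG, indicator_of_mem hζ]

/-- Time integral of a delay equation. -/
theorem integral_delay {T : ℝ} {A : EuclideanSpace ℂ (Fin n) →L[ℂ] EuclideanSpace ℂ (Fin n)}
    {f φ : ℝ → EuclideanSpace ℂ (Fin n)} (hf : IsProfile f) (hφ : IsProfile φ)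
    (h : ∀ t, φ t = f t + A (φ (t - T))) (t : ℝ) :
    ∫ s in (0 : ℝ)..t, φ s = (∫ s in (0 : ℝ)..t, f s) + A (∫ s in (-T)..(t - T), φ s) := by
  have e : ∫ s in (0 : ℝ)..t, φ s = ∫ s in (0 : ℝ)..t, (f s + A (φ (s - T))) :=
    intervalIntegral.integral_congr fun s _ => h s
  have hφT := hφ.comp_sub_right T
  rw [e, intervalIntegral.integral_add (hf.intervalIntegrable _ _)
    ((hφT.clm_comp A).intervalIntegrable _ _),
    A.intervalIntegral_comp_comm (hφT.intervalIntegrable _ _),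
    intervalIntegral.integral_comp_sub_right, zero_sub]

theorem profileFlux_zero (hQ : IsFundamental (odeCoeff r M) Q R)
    (φ : ℝ → EuclideanSpace ℂ (Fin n)) (t : ℝ) :
    profileFlux r Q φ t 0 = ∫ s in (0 : ℝ)..t, φ s := by
  simp [profileFlux, hQ.Q_zero]

/-! ### Sufficiency -/

/-- For the difference of two mild solutions, the trace of the flux at `1` is the delayed trace at
`0`, and the boundary condition determines the trace at `0` from that at `1`. Both therefore vanish
on `[0, N T]` for all `N`, by induction. -/
theorem eqOn_of_isMildSolution (hr : IsSlowness r a b)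
    (hlr : ∀ᵐ ζ ∂spaceMeasure, r ζ * lam ζ = 1) (hQ : IsFundamental (odeCoeff r M) Q R)
    {K L : Matrix (Fin n) (Fin n) ℂ} (hK : IsUnit K) {z₀ : State n}
    {u : ℝ → EuclideanSpace ℂ (Fin p)} {z z' : ℝ → State n}
    (h : IsMildSolution lam M K L z₀ u z) (h' : IsMildSolution lam M K L z₀ u z') :
    EqOn z z' (Ici 0) := by
  obtain ⟨w, hw, hb⟩ := h.exists_flux
  obtain ⟨w', hw', hb'⟩ := h'.exists_flux
  have hd := hw.sub hw'
  set T := travelTime r 1 with hT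
  have hT0 : 0 < T := hr.travelTime_one_pos
  have h1 : (1 : ℝ) ∈ Icc (0 : ℝ) 1 := by simp
  have hRinj : ∀ ζ ∈ Icc (0 : ℝ) 1, ∀ x, R ζ x = 0 → x = 0 := fun ζ hζ x hx => by
    have := DFunLike.congr_fun (hQ.Q_mul_R ζ hζ) x
    simpa [hx] using this.symm
  have hbd : ∀ t, 0 ≤ t → w t 1 - w' t 1 = 0 → w t 0 - w' t 0 = 0 := fun t ht h0 => by
    have e1 := (hb t ht).symm.trans (hb' t ht)
    rw [sub_eq_zero.1 h0, sub_left_inj, neg_inj, ← sub_eq_zero, ← map_sub] at e1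
    have hKi : K⁻¹ * K = 1 := Matrix.nonsing_inv_mul K ((Matrix.isUnit_iff_isUnit_det K).1 hK)
    have e2 : K⁻¹.toEuclideanLin (K.toEuclideanLin (w t 0 - w' t 0)) = w t 0 - w' t 0 := by
      have := DFunLike.congr_fun (map_mul (Matrix.toEuclideanCLM (𝕜 := ℂ) (n := Fin n)) K⁻¹ K)
        (w t 0 - w' t 0)
      rw [hKi, map_one] at this
      exact this.symm
    rw [← e2, e1, map_zero]
  have hw0 : ∀ (N : ℕ) (t : ℝ), 0 ≤ t → t ≤ N * T → w t 0 - w' t 0 = 0 := by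
    intro N
    induction N with
    | zero =>
      intro t ht htN
      have : t = 0 := le_antisymm (by simpa using htN) ht
      exact hbd t ht (hRinj 1 h1 _ ((hd.transport hr hlr hQ h1 t).2 ⟨ht, this ▸ hT0.le⟩))
    | succ N ih =>
      intro t ht htN
      refine hbd t ht (hRinj 1 h1 _ ?_)
      rcases le_total t T with htT | htT
      · exact (hd.transport hr hlr hQ h1 t).2 ⟨ht, htT⟩
      · have := (hd.transport hr hlr hQ h1 (t - T)).1 (by linarith)
        rw [← hT, sub_add_cancel] at this
        rw [this]
        refine ih (t - T) (by linarith) ?_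
        push_cast at htN
        linarith
  have hw0' : ∀ t, 0 ≤ t → w t 0 - w' t 0 = 0 := fun t ht => by
    obtain ⟨N, hN⟩ := exists_nat_ge (t / T)
    exact hw0 N t ht ((div_le_iff₀ hT0).1 hN)
  have hwζ : ∀ t, 0 ≤ t → ∀ ζ ∈ Icc (0 : ℝ) 1, w t ζ - w' t ζ = 0 := fun t ht ζ hζ => by
    refine hRinj ζ hζ _ ?_
    rcases le_total t (travelTime r ζ) with htτ | htτ
    · exact (hd.transport hr hlr hQ hζ t).2 ⟨ht, htτ⟩
    · have := (hd.transport hr hlr hQ hζ (t - travelTime r ζ)).1 (by linarith)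
      rw [sub_add_cancel] at this
      rw [this]
      exact hw0' _ (by linarith)
  have hZ : ∀ t, 0 ≤ t → ∫ s in (0 : ℝ)..t, (z s - z' s) = 0 := fun t ht => by
    refine (Lp.eq_zero_iff_ae_eq_zero).2 ?_
    filter_upwards [hd.smul_flux_ae hlr ht, ae_restrict_mem measurableSet_Ioo] with ζ e1 hζ
    rw [← e1, hwζ t ht ζ (Ioo_subset_Icc_self hζ), smul_zero]
    rfl
  exact fun t ht => sub_eq_zero.1 (eq_zero_of_integral_eq_zero hd.continuousOn hZ t ht)

theorem wellPosed_of_isUnit (hr : IsSlowness r a b)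
    (hlr : ∀ᵐ ζ ∂spaceMeasure, r ζ * lam ζ = 1)
    (hM : ∀ i j, MemLp (fun ζ => M ζ i j) ⊤ spaceMeasure)
    (hQ : IsFundamental (odeCoeff r M) Q R) {K L : Matrix (Fin n) (Fin n) ℂ}
    (Ky Ly : Matrix (Fin m) (Fin n) ℂ) (hK : IsUnit K) : WellPosed p lam M K L Ky Ly := by
  intro z₀ u hu
  set T := travelTime r 1 with hT
  have hT0 : 0 < T := hr.travelTime_one_pos
  set k := K.toEuclideanLin.toContinuousLinearMap with hk
  set k' := K⁻¹.toEuclideanLin.toContinuousLinearMap with hk'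
  set l := L.toEuclideanLin.toContinuousLinearMap with hl
  set B := (inputMatrix n p).toEuclideanLin.toContinuousLinearMap with hB
  have hkk : ∀ x, k (k' x) = x := fun x => by
    have := DFunLike.congr_fun (map_mul (Matrix.toEuclideanCLM (𝕜 := ℂ) (n := Fin n)) K K⁻¹) x
    rw [Matrix.mul_nonsing_inv K ((Matrix.isUnit_iff_isUnit_det K).1 hK), map_one] at this
    exact this.symm
  obtain ⟨v, hv, hv0, hvu⟩ := exists_profile_of_isL2loc hu
  obtain ⟨f₀, hf₀, hf₀0, hf₀z⟩ := exists_initial_profile hr hQ z₀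
  -- the boundary condition, solved for the flux at `0`, is a delay equation for the profile
  set A := -(k' ∘L l ∘L Q 1) with hA
  have hf : IsProfile fun t => f₀ t + -(k' ∘L B) (v t) := hf₀.add (hv.clm_comp (-(k' ∘L B)))
  obtain ⟨φ, hφ, hφ0, hφeq⟩ := exists_profile_delay hT0 A hf (fun t ht => by
    rw [hf₀0 t fun h => by linarith [h.1], hv0 t (by linarith), map_zero, neg_zero, add_zero])
  have hφneg : ∀ t ∈ Ioo (-T) 0, φ t = f₀ t := fun t ht => by
    rw [hφeq, hφ0 (t - T) (by linarith [ht.2]), hv0 t ht.2.le]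
    simp
  obtain ⟨z, hz, hzφ, hzsol⟩ := exists_solution_of_profile hr hlr hM hQ hφ
  have hz0 : z 0 = z₀ := by
    refine Lp.ext ?_
    filter_upwards [hzφ 0, ae_restrict_mem measurableSet_Ioo] with ζ h1 hζ
    have hτ := hr.travelTime_mem_Ioo hζ
    have h2 : r ζ • Q ζ ((r ζ)⁻¹ • R ζ (z₀ ζ)) = Q ζ (R ζ (z₀ ζ)) := by
      have : Q ζ ((r ζ)⁻¹ • R ζ (z₀ ζ)) = (r ζ)⁻¹ • Q ζ (R ζ (z₀ ζ)) :=
        ContinuousLinearMap.map_smul_of_tower (Q ζ) (r ζ)⁻¹ _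
      rw [this, smul_smul, mul_inv_cancel₀ (hr.pos_apply ζ).ne', one_smul]
    rw [h1, profileState, zero_sub, hφneg _ ⟨by linarith [hτ.2], by linarith [hτ.1]⟩,
      hf₀z ζ hζ, h2]
    exact DFunLike.congr_fun (hQ.Q_mul_R ζ (Ioo_subset_Icc_self hζ)) (z₀ ζ)
  have hfree : IsFreeSolution lam M z₀ z (profileFlux r Q φ) :=
    ⟨hz.continuousOn, fun t ht => hz0 ▸ hzsol t ht⟩
  have hw1 : ∀ t, profileFlux r Q φ t 1 = Q 1 (∫ s in (-T)..(t - T), φ s) := fun t => rfl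
  have hmild : IsMildSolution lam M K L z₀ u z := by
    refine hfree.isMildSolution fun t ht => ?_
    have hvi : ∫ s in (0 : ℝ)..t, v s = ∫ s in (0 : ℝ)..t, u s :=
      intervalIntegral.integral_congr_ae (hvu.mono fun s hs hs' => by
        rw [uIoc_of_le ht] at hs'; exact hs hs'.1)
    have hfi : ∫ s in (0 : ℝ)..t, (f₀ s + -(k' ∘L B) (v s)) =
        -(k' ∘L B) (∫ s in (0 : ℝ)..t, u s) := by
      have h1 := (-(k' ∘L B)).intervalIntegral_comp_comm (hv.intervalIntegrable 0 t)
      rw [hvi] at h1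
      rw [← neg_apply, ← h1]
      refine intervalIntegral.integral_congr_ae (Eventually.of_forall fun s hs => ?_)
      rw [uIoc_of_le ht] at hs
      rw [hf₀0 s fun h => by linarith [h.2, hs.1], zero_add]
      rfl
    rw [profileFlux_zero hQ, integral_delay hf hφ hφeq, hfi, hw1]
    change B (∫ s in (0 : ℝ)..t, u s) = -k (-k' (B (∫ s in (0 : ℝ)..t, u s)) +
      -k' (l (Q 1 (∫ s in (-T)..(t - T), φ s)))) - l (Q 1 (∫ s in (-T)..(t - T), φ s))
    rw [map_add, map_neg, map_neg, hkk, hkk]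
    abel
  refine ⟨z, hmild, fun z' hz' => eqOn_of_isMildSolution hr hlr hQ hK hz' hmild, ?_⟩
  set ky := Ky.toEuclideanLin.toContinuousLinearMap with hky
  set ly := Ly.toEuclideanLin.toContinuousLinearMap with hly
  have hy1 := hφ.clm_comp (-ky)
  have hy2 := (hφ.comp_sub_right T).clm_comp (-(ly ∘L Q 1))
  refine ⟨_, (hy1.add hy2).isL2loc, fun t ht => ?_⟩
  obtain ⟨g, hg, -⟩ := hfree.flux t ht
  refine ⟨_, g, hg, ?_⟩
  rw [intervalIntegral.integral_add (hy1.intervalIntegrable _ _) (hy2.intervalIntegrable _ _),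
    (-ky).intervalIntegral_comp_comm (hφ.intervalIntegrable _ _),
    (-(ly ∘L Q 1)).intervalIntegral_comp_comm ((hφ.comp_sub_right T).intervalIntegrable _ _),
    intervalIntegral.integral_comp_sub_right, zero_sub, profileFlux_zero hQ, hw1]
  rw [sub_eq_add_neg]
  rfl

/-! ### Necessity -/

/-- Signals already inside the interval reach the boundary point `1` unhindered, so well-posedness
forces the range of `L` into that of `K`. -/
theorem range_le_of_wellPosed (hr : IsSlowness r a b)
    (hlr : ∀ᵐ ζ ∂spaceMeasure, r ζ * lam ζ = 1)
    (hM : ∀ i j, MemLp (fun ζ => M ζ i j) ⊤ spaceMeasure)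
    (hQ : IsFundamental (odeCoeff r M) Q R) {K L : Matrix (Fin n) (Fin n) ℂ}
    {Ky Ly : Matrix (Fin m) (Fin n) ℂ} (h : WellPosed p lam M K L Ky Ly) :
    LinearMap.range L.toEuclideanLin ≤ LinearMap.range K.toEuclideanLin := by
  rintro _ ⟨x, rfl⟩
  set T := travelTime r 1 with hT
  have hT0 : 0 < T := hr.travelTime_one_pos
  have h1 : (1 : ℝ) ∈ Icc (0 : ℝ) 1 := by simp
  have hφ := IsProfile.indicator_const (-T) 0 (R 1 x)
  obtain ⟨z', hz', -, hsol⟩ := exists_solution_of_profile hr hlr hM hQ hφ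
  obtain ⟨z, hz, -⟩ := h (z' 0) (fun _ => 0) (fun _ _ => MemLp.zero)
  obtain ⟨w, hw, hb⟩ := hz.exists_flux
  have hw' : IsFreeSolution lam M (z' 0) z'
      (profileFlux r Q ((Ico (-T) 0).indicator fun _ => R 1 x)) := ⟨hz'.continuousOn, hsol⟩
  have hd := hw.sub hw'
  have e1 := (hd.transport hr hlr hQ h1 T).2 ⟨hT0.le, le_rfl⟩
  have e2 : w T 1 = T • x := by
    have h2 := congrArg (Q 1) e1
    rw [← mul_apply_eq_comp, hQ.Q_mul_R 1 h1, map_zero, one_apply_eq_self, sub_eq_zero] at h2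
    have h3 : ∫ s in (-T)..0, (Ico (-T) 0).indicator (fun _ => R 1 x) s = T • R 1 x := by
      have : ∫ s in (-T)..0, (Ico (-T) 0).indicator (fun _ => R 1 x) s = ∫ s in (-T)..0, R 1 x := by
        refine intervalIntegral.integral_congr_ae ?_
        filter_upwards [(by simp [ae_iff] : ∀ᵐ s : ℝ, s ≠ 0)] with s hs hs'
        rw [uIoc_of_le (by linarith)] at hs'
        exact indicator_of_mem (show s ∈ Ico (-T) 0 from ⟨hs'.1.le, lt_of_le_of_ne hs'.2 hs⟩) _
      rw [this, intervalIntegral.integral_const, sub_neg_eq_add, zero_add]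
    have h4 : Q 1 (T • R 1 x) = T • Q 1 (R 1 x) :=
      ContinuousLinearMap.map_smul_of_tower (Q 1) T (R 1 x)
    rw [h2, profileFlux, ← hT, sub_self, h3, h4, ← mul_apply_eq_comp, hQ.Q_mul_R 1 h1,
      one_apply_eq_self]
  have e3 := hb T hT0.le
  rw [e2, intervalIntegral.integral_zero, map_zero, eq_comm, sub_eq_zero] at e3
  have e4 : L.toEuclideanLin (T • x) = T • L.toEuclideanLin x :=
    LinearMap.map_smul_of_tower _ T x
  refine ⟨-(T⁻¹ • w T 0), ?_⟩
  have e5 : K.toEuclideanLin (T⁻¹ • w T 0) = T⁻¹ • K.toEuclideanLin (w T 0) :=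
    LinearMap.map_smul_of_tower _ _ _
  rw [map_neg, e5, ← smul_neg, e3, e4, smul_smul, inv_mul_cancel₀ hT0.ne', one_smul]

/-- If `L = K G` and `K v = 0`, the signal `v` can be injected at the boundary point `0` without
violating the boundary condition, which contradicts uniqueness unless `v = 0`. -/
theorem isUnit_of_wellPosed (hr : IsSlowness r a b)
    (hlr : ∀ᵐ ζ ∂spaceMeasure, r ζ * lam ζ = 1)
    (hM : ∀ i j, MemLp (fun ζ => M ζ i j) ⊤ spaceMeasure)
    (hQ : IsFundamental (odeCoeff r M) Q R) {K L : Matrix (Fin n) (Fin n) ℂ}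
    {Ky Ly : Matrix (Fin m) (Fin n) ℂ} (h : WellPosed p lam M K L Ky Ly) : IsUnit K := by
  have hrange := range_le_of_wellPosed hr hlr hM hQ h
  set T := travelTime r 1 with hT
  have hT0 : 0 < T := hr.travelTime_one_pos
  obtain ⟨G, hG⟩ := Module.projective_lifting_property K.toEuclideanLin.rangeRestrict
    (L.toEuclideanLin.codRestrict _ fun x => hrange ⟨x, rfl⟩)
    (LinearMap.surjective_rangeRestrict _)
  have hKG : ∀ x, K.toEuclideanLin (G x) = L.toEuclideanLin x := fun x =>
    congrArg Subtype.val (DFunLike.congr_fun hG x)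
  by_contra hK
  obtain ⟨v, hv0, hKv⟩ : ∃ v, v ≠ 0 ∧ K.toEuclideanLin v = 0 := by
    rw [Matrix.isUnit_iff_isUnit_det, isUnit_iff_ne_zero, not_not,
      ← Matrix.exists_mulVec_eq_zero_iff] at hK
    obtain ⟨v, hv0, hv⟩ := hK
    refine ⟨WithLp.toLp 2 v, by simpa using hv0, ?_⟩
    rw [Matrix.toLpLin_toLp, Matrix.toLin'_apply, hv]
    rfl
  have hf := IsProfile.indicator_const 0 T v
  obtain ⟨φ, hφ, hφ0, hφeq⟩ := exists_profile_delay hT0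
    (-(G.toContinuousLinearMap ∘L Q 1)) hf
    (fun t ht => indicator_of_notMem (fun h => by linarith [h.1]) _)
  have hφneg : ∀ t < 0, φ t = 0 := fun t ht => by
    rw [hφeq, hφ0 (t - T) (by linarith), map_zero, add_zero]
    exact indicator_of_notMem (fun h => by linarith [h.1]) _
  have hφpos : ∀ t ∈ Ico 0 T, φ t = v := fun t ht => by
    rw [hφeq, hφneg (t - T) (by linarith [ht.2]), map_zero, add_zero, indicator_of_mem ht]
  obtain ⟨z, hz, hzφ, hsol⟩ := exists_solution_of_profile hr hlr hM hQ hφ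
  have hz0 : z 0 = 0 := by
    refine (Lp.eq_zero_iff_ae_eq_zero).2 ?_
    filter_upwards [hzφ 0, ae_restrict_mem measurableSet_Ioo] with ζ h1 hζ
    rw [h1, profileState, hφneg _ (by linarith [(hr.travelTime_mem_Ioo hζ).1]), map_zero, smul_zero]
    rfl
  have hmild : IsMildSolution lam M K L (0 : State n)
      (fun _ => (0 : EuclideanSpace ℂ (Fin p))) z := by
    have hfree : IsFreeSolution lam M 0 z (profileFlux r Q φ) :=
      ⟨hz.continuousOn, fun t ht => hz0 ▸ hsol t ht⟩
    refine hfree.isMildSolution fun t ht => ?_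
    have hKf : K.toEuclideanLin (∫ s in (0 : ℝ)..t, (Ico 0 T).indicator (fun _ => v) s) = 0 := by
      have := K.toEuclideanLin.toContinuousLinearMap.intervalIntegral_comp_comm
        (hf.intervalIntegrable 0 t)
      refine this.symm.trans ?_
      refine (intervalIntegral.integral_congr fun s _ => ?_).trans intervalIntegral.integral_zero
      by_cases hs : s ∈ Ico 0 T
      · simp only [indicator_of_mem hs]
        exact hKv
      · simp only [indicator_of_notMem hs, map_zero]
    rw [profileFlux_zero hQ, integral_delay hf hφ hφeq, map_add, hKf, zero_add,
      intervalIntegral.integral_zero, map_zero]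
    change (0 : EuclideanSpace ℂ (Fin n)) =
      -K.toEuclideanLin (-G (Q 1 (∫ s in (-T)..(t - T), φ s))) -
        L.toEuclideanLin (Q 1 (∫ s in (-T)..(t - T), φ s))
    rw [map_neg, hKG, neg_neg, sub_self]
  obtain ⟨z', -, huniq, -⟩ := h 0 (fun _ => 0) (fun _ _ => MemLp.zero)
  have hzT : z T = 0 :=
    (huniq z hmild hT0.le).trans (huniq _ (isMildSolution_zero K L) hT0.le).symm
  have hae : ∀ᵐ ζ ∂spaceMeasure, v = 0 := by
    filter_upwards [hzφ T, (Lp.eq_zero_iff_ae_eq_zero).1 hzT, ae_restrict_mem measurableSet_Ioo]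
      with ζ h1 h2 hζ
    have hτ := hr.travelTime_mem_Ioo hζ
    rw [h2, profileState, hφpos _ ⟨by linarith [hτ.2], by linarith [hτ.1]⟩] at h1
    have h3 := (smul_eq_zero.1 h1.symm).resolve_left (hr.pos_apply ζ).ne'
    have h4 := DFunLike.congr_fun (hQ.R_mul_Q ζ (Ioo_subset_Icc_self hζ)) v
    rw [mul_apply_eq_comp, h3, map_zero] at h4
    exact h4.symm
  have hne : (ae spaceMeasure).NeBot := by
    rw [ae_neBot, spaceMeasure, Ne, Measure.restrict_eq_zero]
    simp
  exact hv0 (hae.exists.choose_spec)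

end

end WaveNetwork

end

theorem proposition2 (n p m : ℕ) (hpn : p ≤ n)
    (lam : ℝ → ℝ) (hlam : MemLp lam ⊤ WaveNetwork.spaceMeasure)
    (hlam_pos : ∃ ε : ℝ, 0 < ε ∧ ∀ᵐ ζ ∂WaveNetwork.spaceMeasure, ε ≤ lam ζ)
    (M : ℝ → Matrix (Fin n) (Fin n) ℂ)
    (hM : ∀ i j, MemLp (fun ζ => M ζ i j) ⊤ WaveNetwork.spaceMeasure)
    (K L : Matrix (Fin n) (Fin n) ℂ) (Ky Ly : Matrix (Fin m) (Fin n) ℂ) :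
    WaveNetwork.WellPosed p lam M K L Ky Ly ↔ IsUnit K := by
  obtain ⟨r, a, b, hr, hlr⟩ := WaveNetwork.exists_slowness hlam hlam_pos
  obtain ⟨Q, R, hQ⟩ := WaveNetwork.exists_isFundamental (WaveNetwork.memLp_odeCoeff hr hM)
  exact ⟨WaveNetwork.isUnit_of_wellPosed hr hlr hM hQ,
    WaveNetwork.wellPosed_of_isUnit hr hlr hM hQ Ky Ly⟩
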